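/- Let $X=(X_n)_{n\in\mathbb Z}$ be a stationary, irreducible Markov process of memory one and period $1$ with values in a finite set $A$ with at least two elements, and let $a\in A$. Put $\widehat X=(\mathbf 1\{X_n=a\})_{n\in\mathbb Z}$ and $X_{[-t,t]}=(X_i)_{i\in\mathbb Z,\,|i|\le t}$. A *marker factor* is a measurable shift-equivariant map $\xi=\xi(\widehat X)\in\{0,1,2,\dots\}^{\mathbb Z}$ such that $\xi_0>0$ implies $\widehat X_0=1$, and $\mathbf P[\xi_0\ge r]>0$ for every integer $r>0$. For such a $\xi$ and $r\ge 1$, the *$r$-skeleton* $S_r=S_r(X)$ covering $0$ is the interval $[\alpha,\beta]\ni 0$ of integers with $\xi_\alpha,\xi_{\beta+1}\ge r>\xi_i$ for all $\alpha<i\le\beta$, together with the labels $(\widehat X_i,\min(\xi_i,r))_{\alpha\le i\le\beta}$; its size is $|S_r|=\beta-\alpha+1$. The event $\{X_{[-t,t]}\Rrightarrow S_r(X)\}$ ("$X_{[-t,t]}$ determines $S_r(X)$") is that, conditionally on the observed value of $X_{[-t,t]}$, $S_r(X)$ is almost surely constant. For $t_i\to\infty$, $f(t_i)=\Delta(t_i)$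 means that $f(t_i)=O(t_i^{-k})$ as $i\to\infty$ for every $k\ge1$. (1) There exist a marker factor $\xi=\xi(\widehat X)$, a constant $c>0$ and a choice of a rank $r=r(n)$ for every $n\in\mathbb N$ such that, as $n\to\infty$, $$\mathbf P\big[X_{[-n,n]}\Rrightarrow S_{r(n)}(X)\big]=1-\Delta(n)\quad\text{and}\quad \mathbf P\Big[\frac{n}{\log^c n}\le |S_{r(n)}(X)|\le n\Big]=1-\Delta(n).$$ (2) For all large enough $c>0$ and $L_1>0$ (larger than some constant that depends only on $X$ and $a$), and for every increasing sequence of reals $(L_r)_{r\ge1}$ with this first term and with $L_r/\log^c L_r>L_{r-1}$ for all $r\ge2$, there exists a marker factor $\xi=\xi(\widehat X)$ such that, as $r\to\infty$, $$\mathbf P\big[X_{[-L_r,L_r]}\Rrightarrow S_r(X)\big]=1-\Delta(L_r)\quad\text{and}\quad \mathbf P\Big[\frac{L_r}{\log^c L_r}\le |S_r(X)|\le L_r\Big]=1-\Delta(L_r).$$ -/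

import Mathlib

open MeasureTheory ProbabilityTheory Filter Topology Asymptotics

/-- The left shift on two-sided sequences. -/
def shift {B : Type*} (x : ℤ → B) : ℤ → B := fun i => x (i + 1)

/-- The law `μ` on `A^ℤ` is that of a stationary aperiodic Markov process of memory one. The
conditional probabilities are the elementary ones, given any finite past of positive probability. -/
structure IsAperiodicMarkov {A : Type*} [MeasurableSpace A] (μ : Measure (ℤ → A)) : Prop where
  isProbabilityMeasure : IsProbabilityMeasure μ
  stationary : MeasurePreserving (shift : (ℤ → A) → (ℤ → A)) μ μ
  memory_one : ∀ (n : ℕ) (w : ℤ → A),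
    μ {x | ∀ i ∈ Set.Icc (-((n : ℤ) + 1)) (-1), x i = w i} ≠ 0 →
      μ[{x | x 0 = w 0} | {x | ∀ i ∈ Set.Icc (-((n : ℤ) + 1)) (-1), x i = w i}] =
        μ[{x | x 0 = w 0} | {x | x (-1) = w (-1)}]
  irreducible : ∀ b b' : A, ∃ n : ℕ, 0 < n ∧ 0 < μ {x | x 0 = b ∧ x (n : ℤ) = b'}
  /-- The greatest common divisor of the set of all `n ≥ 1` with `P[X_0 = b, X_n = b'] > 0` is `1`. -/
  period_one : ∀ (b b' : A) (d : ℕ),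
    (∀ n : ℕ, 0 < n → 0 < μ {x | x 0 = b ∧ x (n : ℤ) = b'} → d ∣ n) → d = 1

open Classical in
/-- The distribution of the state `a`: the sequence `1{x_n = a}` of indicators. -/
noncomputable def stateDistribution {A : Type*} (a : A) (x : ℤ → A) : ℤ → Bool :=
  fun i => decide (x i = a)

/-- `ξ` is a marker factor of the distribution of `a` in the process with law `μ`. -/
structure IsMarkerFactor {A : Type*} [MeasurableSpace A] (μ : Measure (ℤ → A)) (a : A)
    (ξ : (ℤ → Bool) → (ℤ → ℕ)) : Prop where
  measurable : Measurable ξ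
  equivariant : ∀ y, ξ (shift y) = shift (ξ y)
  marks : ∀ y, 0 < ξ y 0 → y 0 = true
  pos : ∀ r : ℕ, 0 < r → 0 < μ {x | r ≤ ξ (stateDistribution a x) 0}

/-- The interval `[α, β]` is covered by a skeleton of rank `r` for the marker sequence `m`. -/
structure IsRSkeleton (m : ℤ → ℕ) (r : ℕ) (α β : ℤ) : Prop where
  le : α ≤ β
  left_ge : r ≤ m α
  right_ge : r ≤ m (β + 1)
  interior_lt : ∀ i, α < i → i ≤ β → m i < r

/-- A labelled interval `[left, right]` of integers. The labels are a word on that interval,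
written as a partial function on `ℤ`. -/
@[ext] structure Skeleton where
  left : ℤ
  right : ℤ
  name : ℤ → Option (Bool × ℕ)

/-- The number of coordinates that are covered. -/
def Skeleton.size (S : Skeleton) : ℤ := S.right - S.left + 1

/-- The skeleton on `[α, β]`, read as one of rank `r`, in the pair of sequences `(y, m)`: every
coordinate is labelled by the symbol of `y` and by the marker, where markers `≥ r` are only known
to be `≥ r`. -/
def mkSkeleton (y : ℤ → Bool) (m : ℤ → ℕ) (r : ℕ) (α β : ℤ) : Skeleton where
  left := α
  right := β
  name := fun i => if α ≤ i ∧ i ≤ β then some (y i, min (m i) r) else none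

/-- The `r`-skeleton that covers the coordinate `o`, as a set with at most one element
(with none if there is no such skeleton). -/
def skeletonAt (y : ℤ → Bool) (m : ℤ → ℕ) (r : ℕ) (o : ℤ) : Set Skeleton :=
  {S | ∃ α β : ℤ, IsRSkeleton m r α β ∧ α ≤ o ∧ o ≤ β ∧ S = mkSkeleton y m r α β}

theorem skeletonAt_subsingleton (y : ℤ → Bool) (m : ℤ → ℕ) (r : ℕ) (o : ℤ) :
    (skeletonAt y m r o).Subsingleton := by
  rintro _ ⟨α, β, h, h1, h2, rfl⟩ _ ⟨α', β', h', h1', h2', rfl⟩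
  have key : ∀ {α β α' β' : ℤ}, IsRSkeleton m r α β → IsRSkeleton m r α' β' →
      α ≤ o → o ≤ β → α' ≤ o → o ≤ β' → α' ≤ α ∧ β ≤ β' := by
    intro α β α' β' h h' h1 h2 h1' h2'
    constructor
    · by_contra hc
      have := h.interior_lt α' (by lia) (by lia)
      have := h'.left_ge
      lia
    · by_contra hc
      have := h.interior_lt (β' + 1) (by lia) (by lia)
      have := h'.right_ge
      lia
  have e1 := key h h' h1 h2 h1' h2'
  have e2 := key h' h h1' h2' h1 h2
  have ea : α = α' := by lia
  have eb : β = β' := by lia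
  subst ea eb
  rfl

/-- The random skeleton `S_r(X)` of rank `r` that covers the coordinate `0`. -/
noncomputable def randomSkeleton {A : Type*} (a : A) (ξ : (ℤ → Bool) → (ℤ → ℕ)) (r : ℕ)
    (x : ℤ → A) : Set Skeleton :=
  skeletonAt (stateDistribution a x) (ξ (stateDistribution a x)) r 0

/-- The restriction of `x` to the integers in `[-t, t]`. -/
def window {A : Type*} (t : ℝ) (x : ℤ → A) : Set.Icc (-⌊t⌋) ⌊t⌋ → A := fun i => x i

/-- The event that `X` determines `Y`, for a random variable `X` with countably many values: the
set of all `ω` such that `Y` is almost surely equal to `Y ω` given `X = X ω`. -/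
def determines {Ω B C : Type*} [MeasurableSpace Ω] [Countable B] (μ : Measure Ω) (X : Ω → B)
    (Y : Ω → C) : Set Ω :=
  {ω | ∀ᵐ ω' ∂μ, X ω' = X ω → Y ω' = Y ω}

/-- The event that `X_{[-t, t]}` determines `S_r(X)`. -/
def determinesSkeleton {A : Type*} [Finite A] [MeasurableSpace A] (μ : Measure (ℤ → A)) (a : A)
    (ξ : (ℤ → Bool) → (ℤ → ℕ)) (r : ℕ) (t : ℝ) : Set (ℤ → A) :=
  determines μ (window t) (randomSkeleton a ξ r)

/-- The event `t / log^c t ≤ |S_r(X)| ≤ t`. -/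
def skeletonSizeEvent {A : Type*} (a : A) (ξ : (ℤ → Bool) → (ℤ → ℕ)) (r : ℕ) (c t : ℝ) :
    Set (ℤ → A) :=
  {x | ∃ S ∈ randomSkeleton a ξ r x, t / Real.log t ^ c ≤ (S.size : ℝ) ∧ (S.size : ℝ) ≤ t}

/-! The marker of rank `r` is built from the marks of rank `r - 1` by thinning at scale `R`, about
`L r / log ^ 4 (L r)`. Since the period is `1` and `A` has two elements, some word `v` of indicators
follows the state `a` with conditional probability `p` strictly between `0` and `1`, and ends in
`a`. The chain renews at `a`, so `v` repeated `k` times has conditional probability exactly `p ^ k`,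
and `k` of order `log R` makes this comparable to `1 / R`. Let `P` be the occurrence of this power
of `v`. A mark of rank `r - 1` is a candidate if `P` occurs at most `R` before it, and a candidate
is kept if no candidate lies at most `R` before it.

Kept marks are more than `R` apart, and keeping depends on at most `3 * R` past coordinates, because
the test concerns candidates and not kept marks. This bounded range is why a window determines the
skeleton.

Kept marks are also frequent. Whatever the past, `P` avoids a stretch of length `2 * R` with
probability at least `1 / 2`, then occurs within `R` with probability at least a constant over `log
R` (the word takes time of order `log R`, and there are `R / log R` disjoint trials), then an old
mark follows within `R` with probability at least `1 / 2`. The first candidate after the empty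
stretch is kept. Thus a time `5 * R` contains a kept mark with probability at least `c / log R`, and
`log ^ 3 (L r)` such blocks all fail with probability at most `exp (-b * log ^ 2 (L r))`, which
decays faster than any power. The blocks together last at most `L r / 4`.

The key steps are `exists_word`, `mem_hitSet_thinning`, `IsRecurrentLaw.exists_scale`,
`IsRecurrentLaw.exists_markSystem` and `exists_markerFactor`. Part (2) uses the given scales; part
(1) uses scales that grow by a factor `log ^ 8`, so that every `n` is close to one of them. -/

/-! ### Events of the past and translations -/

/-- `C` is determined by finitely many coordinates up to `m`. -/
def PastEvent {B : Type*} (m : ℤ) (C : Set (ℤ → B)) : Prop :=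
  ∃ n : ℤ, ∀ x x' : ℤ → B, (∀ i, n ≤ i → i ≤ m → x i = x' i) → x ∈ C → x' ∈ C

namespace PastEvent

variable {B : Type*} {m m' : ℤ} {C D : Set (ℤ → B)}

theorem univ : PastEvent m (Set.univ : Set (ℤ → B)) := ⟨0, fun _ _ _ _ => trivial⟩

theorem mono (h : PastEvent m C) (hm : m ≤ m') : PastEvent m' C := by
  obtain ⟨n, hn⟩ := h
  exact ⟨n, fun x x' hx => hn x x' fun i h1 h2 => hx i h1 (h2.trans hm)⟩

theorem inter (hC : PastEvent m C) (hD : PastEvent m D) : PastEvent m (C ∩ D) := by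
  obtain ⟨n, hn⟩ := hC
  obtain ⟨k, hk⟩ := hD
  refine ⟨min n k, fun x x' hx h => ⟨hn x x' (fun i h1 h2 => hx i ?_ h2) h.1,
    hk x x' (fun i h1 h2 => hx i ?_ h2) h.2⟩⟩
  · exact (min_le_left _ _).trans h1
  · exact (min_le_right _ _).trans h1

theorem compl (hC : PastEvent m C) : PastEvent m Cᶜ := by
  obtain ⟨n, hn⟩ := hC
  exact ⟨n, fun x x' hx h h' => h (hn x' x (fun i h1 h2 => (hx i h1 h2).symm) h')⟩

theorem diff (hC : PastEvent m C) (hD : PastEvent m D) : PastEvent m (C \ D) :=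
  hC.inter hD.compl

theorem coord {i : ℤ} (hi : i ≤ m) (s : Set B) : PastEvent m {x : ℤ → B | x i ∈ s} :=
  ⟨i, fun x x' hx h => by
    have := hx i le_rfl hi
    simpa [this] using h⟩

theorem forall_lt (k : ℕ) {G : ℕ → Set (ℤ → B)} (h : ∀ t < k, PastEvent m (G t)) :
    PastEvent m {x | ∀ t < k, x ∈ G t} := by
  induction k with
  | zero => exact ⟨0, fun _ _ _ _ t ht => absurd ht (by simp)⟩
  | succ k ih =>
    have := (ih fun t ht => h t (by omega)).inter (h k (by omega))
    convert this using 1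
    ext x
    simp only [Set.mem_ofPred_eq, Set.mem_inter_iff]
    exact Nat.forall_lt_succ_right

theorem measurableSet [Finite B] [MeasurableSpace B] [DiscreteMeasurableSpace B]
    (hC : PastEvent m C) : MeasurableSet C := by
  obtain ⟨n, hn⟩ := hC
  let ρ : (ℤ → B) → (Set.Icc n m → B) := fun x i => x i
  have hρ : Measurable ρ := measurable_pi_lambda _ fun i => measurable_pi_apply _
  have : C = ρ ⁻¹' (ρ '' C) := by
    ext x'
    refine ⟨fun h => ⟨x', h, rfl⟩, ?_⟩
    rintro ⟨x, hx, hxx⟩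
    exact hn x x' (fun i h1 h2 => congrFun hxx ⟨i, h1, h2⟩) hx
  rw [this]
  exact hρ (Set.toFinite _).measurableSet

end PastEvent

theorem measureReal_eq_sum_inter {Ω W : Type*} [MeasurableSpace Ω] [Fintype W]
    [MeasurableSpace W] [MeasurableSingletonClass W] (μ : Measure Ω) [IsFiniteMeasure μ]
    {g : Ω → W} (hg : Measurable g) (D : Set Ω) :
    μ.real D = ∑ w, μ.real (D ∩ g ⁻¹' {w}) := by
  have h := sum_measureReal_preimage_singleton (μ := μ.restrict D) (f := g) Finset.univ
    (fun w _ => hg (measurableSet_singleton w))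
  simp only [Finset.coe_univ, Set.preimage_univ, measureReal_restrict_apply_univ] at h
  rw [← h]
  refine Finset.sum_congr rfl fun w _ => ?_
  rw [measureReal_restrict_apply (hg (measurableSet_singleton w)), Set.inter_comm]

/-- Translation of two-sided sequences by `m`. -/
def shiftBy {B : Type*} (m : ℤ) (x : ℤ → B) : ℤ → B := fun i => x (i + m)

theorem measurable_shiftBy {B : Type*} [MeasurableSpace B] (m : ℤ) :
    Measurable (shiftBy m : (ℤ → B) → (ℤ → B)) :=
  measurable_pi_lambda _ fun _ => measurable_pi_apply _

theorem shiftBy_shiftBy {B : Type*} (m n : ℤ) (x : ℤ → B) :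
    shiftBy m (shiftBy n x) = shiftBy (m + n) x := by
  funext i; simp [shiftBy, add_assoc]

theorem measurePreserving_shiftBy {B : Type*} [MeasurableSpace B] {μ : Measure (ℤ → B)}
    (h : MeasurePreserving (shift : (ℤ → B) → (ℤ → B)) μ μ) (m : ℤ) :
    MeasurePreserving (shiftBy m : (ℤ → B) → (ℤ → B)) μ μ := by
  have hnat : ∀ k : ℕ, MeasurePreserving (shiftBy (k : ℤ) : (ℤ → B) → (ℤ → B)) μ μ := by
    intro k
    have e : (shiftBy (k : ℤ) : (ℤ → B) → (ℤ → B)) = shift^[k] := by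
      induction k with
      | zero => funext x i; simp [shiftBy]
      | succ k ih =>
        rw [Function.iterate_succ', ← ih]
        funext x i
        simp only [shiftBy, shift, Function.comp]
        congr 1; push_cast; ring
    rw [e]; exact h.iterate k
  obtain ⟨k, rfl | rfl⟩ := m.eq_nat_or_neg
  · exact hnat k
  · refine ⟨measurable_shiftBy _, ?_⟩
    ext s hs
    rw [Measure.map_apply (measurable_shiftBy _) hs,
      ← (hnat k).measure_preimage (measurable_shiftBy _ hs).nullMeasurableSet]
    congr 1
    ext x
    simp only [Set.mem_preimage, shiftBy_shiftBy, neg_add_cancel]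
    have : shiftBy 0 x = x := by funext i; simp [shiftBy]
    rw [this]

theorem measureReal_preimage_shiftBy {B : Type*} [MeasurableSpace B] {μ : Measure (ℤ → B)}
    (h : MeasurePreserving (shift : (ℤ → B) → (ℤ → B)) μ μ) {C : Set (ℤ → B)}
    (hC : MeasurableSet C) (m : ℤ) : μ.real (shiftBy m ⁻¹' C) = μ.real C :=
  (measurePreserving_shiftBy h m).measureReal_preimage hC.nullMeasurableSet

theorem PastEvent.preimage_shiftBy {B : Type*} {m : ℤ} {C : Set (ℤ → B)}
    (hC : PastEvent m C) (k : ℤ) : PastEvent (m + k) (shiftBy k ⁻¹' C) := by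
  obtain ⟨n, hn⟩ := hC
  refine ⟨n + k, fun x x' hx h => hn _ _ (fun i h1 h2 => hx (i + k) ?_ ?_) h⟩ <;> omega

/-! ### The Markov property for events of the past -/

namespace IsAperiodicMarkov

variable {A : Type*} [Finite A] [MeasurableSpace A] [DiscreteMeasurableSpace A]
  {μ : Measure (ℤ → A)}

/-- Splitting by the word seen on a long enough interval ending at `-1`, each piece is either empty
or a full cylinder, to which `memory_one` applies. -/
theorem one_step_neg_one (hX : IsAperiodicMarkov μ) {C : Set (ℤ → A)} (hC : PastEvent (-1) C)
    (b b' : A) :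
    μ.real (C ∩ {x | x (-1) = b} ∩ {x | x 0 = b'}) =
      (μ[{x | x 0 = b'} | {x | x (-1) = b}]).toReal * μ.real (C ∩ {x | x (-1) = b}) := by
  have := hX.isProbabilityMeasure
  have := Fintype.ofFinite A
  obtain ⟨n', hn'⟩ := hC
  obtain ⟨n, hn⟩ : ∃ n : ℕ, -((n : ℤ) + 1) ≤ n' := ⟨n'.natAbs, by omega⟩
  classical
  let I : Set ℤ := Set.Icc (-((n : ℤ) + 1)) (-1)
  let ρ : (ℤ → A) → (I → A) := fun x i => x i
  have hρ : Measurable ρ := measurable_pi_lambda _ fun i => measurable_pi_apply _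
  rw [measureReal_eq_sum_inter μ hρ, measureReal_eq_sum_inter μ hρ (C ∩ _), Finset.mul_sum]
  refine Finset.sum_congr rfl fun v _ => ?_
  by_cases hv : ∃ x, x ∈ C ∩ {x | x (-1) = b} ∩ ρ ⁻¹' {v}
  · obtain ⟨x, ⟨hxC, hxb⟩, hxv⟩ := hv
    let w : ℤ → A := fun i => if i = 0 then b' else x i
    have hw0 : w 0 = b' := by simp [w]
    have hw1 : w (-1) = b := by simpa [w] using hxb
    have hwI : ∀ i ∈ I, w i = x i := by
      intro i hi
      have : i ≠ 0 := by have := hi.2; omega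
      simp [w, this]
    have hZ : C ∩ {x | x (-1) = b} ∩ ρ ⁻¹' {v} = {x | ∀ i ∈ I, x i = w i} := by
      ext z
      constructor
      · rintro ⟨_, hz⟩ i hi
        have h1 : ρ z = ρ x := hz.trans hxv.symm
        rw [hwI i hi]; exact congrFun h1 ⟨i, hi⟩
      · intro hz
        have hz' : ∀ i ∈ I, z i = x i := fun i hi => (hz i hi).trans (hwI i hi)
        refine ⟨⟨hn' x z (fun i h1 h2 => (hz' i ⟨hn.trans h1, h2⟩).symm) hxC, ?_⟩, ?_⟩
        · exact (hz' (-1) ⟨by omega, le_rfl⟩).trans hxb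
        · refine Eq.trans ?_ hxv
          funext i; exact hz' i i.2
    have hm : MeasurableSet {x : ℤ → A | ∀ i ∈ I, x i = w i} := by
      rw [← hZ]
      exact ((PastEvent.measurableSet ⟨n', hn'⟩).inter
        (PastEvent.measurableSet (PastEvent.coord le_rfl {b}))).inter
        (hρ (measurableSet_singleton v))
    have e : C ∩ {x | x (-1) = b} ∩ {x | x 0 = b'} ∩ ρ ⁻¹' {v} =
        {x | ∀ i ∈ I, x i = w i} ∩ {x | x 0 = b'} := by
      rw [← hZ]; ext z; simp only [Set.mem_inter_iff]; tauto
    rw [e, hZ]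
    by_cases h0 : μ {x | ∀ i ∈ I, x i = w i} = 0
    · simp [measureReal_def, measure_mono_null Set.inter_subset_left h0, h0]
    · have h := hX.memory_one n w h0
      rw [hw0, hw1] at h
      rw [← h, measureReal_def, measureReal_def, ← ENNReal.toReal_mul, cond_mul_eq_inter hm]
  · have e : C ∩ {x | x (-1) = b} ∩ ρ ⁻¹' {v} = ∅ := by
      rw [Set.eq_empty_iff_forall_notMem]; exact fun x hx => hv ⟨x, hx⟩
    have e' : C ∩ {x | x (-1) = b} ∩ {x | x 0 = b'} ∩ ρ ⁻¹' {v} = ∅ := by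
      rw [Set.eq_empty_iff_forall_notMem]; exact fun x hx => hv ⟨x, hx.1.1, hx.2⟩
    simp [e, e']

theorem exists_transition (hX : IsAperiodicMarkov μ) : ∃ q : A → A → ℝ, ∀ m C b b',
    PastEvent m C → μ.real (C ∩ {x | x m = b} ∩ {x | x (m + 1) = b'}) =
      q b b' * μ.real (C ∩ {x | x m = b}) := by
  refine ⟨fun b b' => (μ[{x | x 0 = b'} | {x | x (-1) = b}]).toReal, fun m C b b' hC => ?_⟩
  have h := hX.one_step_neg_one (C := shiftBy (-(m + 1)) ⁻¹' C)
    (by simpa using hC.preimage_shiftBy (-(m + 1))) b b'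
  have hb : PastEvent m (C ∩ {x | x m = b}) := hC.inter (PastEvent.coord le_rfl {b})
  have hb' : PastEvent (m + 1) (C ∩ {x | x m = b} ∩ {x | x (m + 1) = b'}) :=
    (hb.mono (by omega)).inter (PastEvent.coord le_rfl {b'})
  rw [← measureReal_preimage_shiftBy hX.stationary hb.measurableSet (-(m + 1)),
    ← measureReal_preimage_shiftBy hX.stationary hb'.measurableSet (-(m + 1))]
  convert h using 3
  · ext x
    simp [shiftBy, show m + (-1 + -m) = -1 by ring, show m + 1 + (-1 + -m) = 0 by ring]
  · ext x
    simp [shiftBy, show m + (-1 + -m) = -1 by ring]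

/-- The point is that `κ` depends neither on the time `m` nor on the past `C`. Induction on `n`,
splitting by the next state. -/
theorem exists_future (hX : IsAperiodicMarkov μ) (n : ℕ) (B : ℕ → Set A) (b : A) :
    ∃ κ : ℝ, ∀ m C, PastEvent m C →
      μ.real (C ∩ {x | x m = b} ∩ {x | ∀ t < n, x (m + 1 + t) ∈ B t}) =
        κ * μ.real (C ∩ {x | x m = b}) := by
  have := hX.isProbabilityMeasure
  have := Fintype.ofFinite A
  classical
  induction n generalizing B b with
  | zero => exact ⟨1, fun m C _ => by simp⟩
  | succ n ih =>
    choose κ hκ using fun b' => ih (fun t => B (t + 1)) b'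
    obtain ⟨q, hq⟩ := hX.exists_transition
    refine ⟨∑ b', if b' ∈ B 0 then κ b' * q b b' else 0, fun m C hC => ?_⟩
    rw [measureReal_eq_sum_inter μ (measurable_pi_apply (m + 1)), Finset.sum_mul]
    refine Finset.sum_congr rfl fun b' _ => ?_
    split_ifs with hb'
    · rw [mul_assoc, ← hq m C b b' hC, ← hκ b' (m + 1) (C ∩ {x | x m = b})
        ((hC.inter (PastEvent.coord le_rfl {b})).mono (by omega))]
      congr 1
      ext x
      simp only [Set.mem_inter_iff, Set.mem_ofPred_eq, Set.mem_preimage, Set.mem_singleton_iff]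
      constructor
      · rintro ⟨⟨h1, h2⟩, h3⟩
        refine ⟨⟨h1, h3⟩, fun t ht => ?_⟩
        have := h2 (t + 1) (by omega)
        push_cast at this
        rwa [show m + 1 + 1 + (t : ℤ) = m + 1 + (t + 1) by ring]
      · rintro ⟨⟨h1, h3⟩, h2⟩
        refine ⟨⟨h1, fun t ht => ?_⟩, h3⟩
        rcases t with _ | t
        · simpa [h3] using hb'
        · have := h2 t (by omega)
          push_cast
          rwa [show m + 1 + 1 + (t : ℤ) = m + 1 + (t + 1) by ring] at this
    · rw [zero_mul]
      convert measureReal_empty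
      rw [Set.eq_empty_iff_forall_notMem]
      rintro x ⟨⟨_, h2⟩, h3⟩
      have := h2 0 (by omega)
      simp only [Nat.cast_zero, add_zero] at this
      rw [Set.mem_preimage, Set.mem_singleton_iff] at h3
      exact hb' (h3 ▸ this)

end IsAperiodicMarkov

/-! ### Recurrent binary laws, and the reduction to them -/

/-- Some event `G i` with `m < i ≤ m + M` occurs. -/
def hitSet {B : Type*} (G : ℤ → Set (ℤ → B)) (m : ℤ) (M : ℕ) : Set (ℤ → B) :=
  {y | ∃ t : ℕ, 1 ≤ t ∧ t ≤ M ∧ y ∈ G (m + t)}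

/-- Whatever the past, the probability that none of the next `M` events `G i` occurs is at
most `κ`. -/
def AvoidanceBound {B : Type*} [MeasurableSpace B] (ν : Measure (ℤ → B)) (G : ℤ → Set (ℤ → B))
    (M : ℕ) (κ : ℝ) : Prop :=
  ∀ m C, PastEvent m C → ν.real (C \ hitSet G m M) ≤ κ * ν.real C

/-- A stationary law of binary sequences in which the symbol `true` recurs, and in which it is
followed by the word `v 0, …, v (ℓ - 1)` with probability `p`, whatever the past. -/
structure IsRecurrentLaw (ν : Measure (ℤ → Bool)) (v : ℕ → Bool) (ℓ : ℕ) (p δ : ℝ) (N : ℕ) :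
    Prop where
  isProbabilityMeasure : IsProbabilityMeasure ν
  stationary : MeasurePreserving (shift : (ℤ → Bool) → (ℤ → Bool)) ν ν
  length_pos : 0 < ℓ
  last : v (ℓ - 1) = true
  p_pos : 0 < p
  p_lt_one : p < 1
  word : ∀ m C, PastEvent m C →
    ν.real (C ∩ {y | y m = true} ∩ {y | ∀ t < ℓ, y (m + 1 + (t : ℕ)) = v t}) =
      p * ν.real (C ∩ {y | y m = true})
  δ_pos : 0 < δ
  δ_le_one : δ ≤ 1
  recurrent : AvoidanceBound ν (fun i => {y | y i = true}) N (1 - δ)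

theorem PastEvent.preimage_stateDistribution {A : Type*} (a : A) {m : ℤ} {C : Set (ℤ → Bool)}
    (hC : PastEvent m C) : PastEvent m (stateDistribution a ⁻¹' C) := by
  obtain ⟨n, hn⟩ := hC
  refine ⟨n, fun x x' hx h => hn _ _ (fun i h1 h2 => ?_) h⟩
  simp [stateDistribution, hx i h1 h2]

namespace IsAperiodicMarkov

theorem measure_state_pos {A : Type*} [MeasurableSpace A] {μ : Measure (ℤ → A)}
    (hX : IsAperiodicMarkov μ) (b : A) : 0 < μ {x | x 0 = b} := by
  obtain ⟨n, _, hn⟩ := hX.irreducible b b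
  exact hn.trans_le (measure_mono fun x hx => hx.1)

theorem measurableSet_pair {A : Type*} [MeasurableSpace A] [DiscreteMeasurableSpace A] (i j : ℤ) (s t : Set A) :
    MeasurableSet {x : ℤ → A | x i ∈ s ∧ x j ∈ t} :=
  (measurable_pi_apply i (MeasurableSet.of_discrete (s := s))).inter
    (measurable_pi_apply j (MeasurableSet.of_discrete (s := t)))

variable {A : Type*} [Finite A] [MeasurableSpace A] [DiscreteMeasurableSpace A]
  {μ : Measure (ℤ → A)}

theorem measure_pair {A : Type*} [MeasurableSpace A] [DiscreteMeasurableSpace A]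
    {μ : Measure (ℤ → A)} (hX : IsAperiodicMarkov μ) (i j : ℤ) (s t : Set A) :
    μ {x | x i ∈ s ∧ x j ∈ t} = μ {x | x 0 ∈ s ∧ x (j - i) ∈ t} := by
  rw [← (measurePreserving_shiftBy hX.stationary i).measure_preimage
    (measurableSet_pair 0 (j - i) s t).nullMeasurableSet]
  congr 1
  ext x
  simp [shiftBy]

/-- Otherwise every possible return time is a sure one. Subtracting the least return time `g` from
any return time then leaves `0` or a return time, so `g` divides them all and aperiodicity gives `g
= 1`. Then `a` is absorbing, against irreducibility. -/
theorem exists_random_return {A : Type*} [MeasurableSpace A] [DiscreteMeasurableSpace A]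
    {μ : Measure (ℤ → A)} [Nontrivial A] (hX : IsAperiodicMarkov μ) (a : A) :
    ∃ ℓ : ℕ, 0 < ℓ ∧ 0 < μ {x | x 0 = a ∧ x (ℓ : ℤ) = a} ∧
      0 < μ {x | x 0 = a ∧ x (ℓ : ℤ) ≠ a} := by
  classical
  by_contra! H
  simp only [nonpos_iff_eq_zero] at H
  have hex := hX.irreducible a a
  obtain ⟨hg0, hg⟩ := Nat.find_spec hex
  set g := Nat.find hex with hgdef
  have h1 : g = 1 := by
    refine hX.period_one a a g fun n _ hn => ?_
    induction n using Nat.strong_induction_on with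
    | _ n ih =>
      rcases Nat.eq_zero_or_pos n with rfl | hn0
      · exact dvd_zero g
      have hgn : g ≤ n := Nat.find_min' hex ⟨hn0, hn⟩
      rcases hgn.eq_or_lt with h | hlt
      · exact h ▸ dvd_rfl
      have hpos : 0 < μ {x | x 0 = a ∧ x ((n - g : ℕ) : ℤ) = a} := by
        have e := hX.measure_pair g n {a} {a}
        simp only [Set.mem_singleton_iff] at e
        rw [Nat.cast_sub hgn, ← e]
        refine hn.trans_le ?_
        calc μ {x | x 0 = a ∧ x (n : ℤ) = a}
            ≤ μ ({x | x (g : ℤ) = a ∧ x (n : ℤ) = a} ∪ {x | x 0 = a ∧ x (g : ℤ) ≠ a}) := by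
              refine measure_mono fun x hx => ?_
              by_cases h : x (g : ℤ) = a
              · exact Or.inl ⟨h, hx.2⟩
              · exact Or.inr ⟨hx.1, h⟩
          _ ≤ _ := (measure_union_le _ _).trans (by rw [H g hg0 hg, add_zero])
      have := ih (n - g) (by omega) (by omega) hpos
      exact (Nat.dvd_sub_iff_left hgn dvd_rfl).1 this
  have hstep : μ {x | x 0 = a ∧ x 1 ≠ a} = 0 := by
    have := H g hg0 hg
    rw [h1] at this
    exact_mod_cast this
  have hall : ∀ n : ℕ, μ {x | x 0 = a ∧ x (n : ℤ) ≠ a} = 0 := by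
    intro n
    induction n with
    | zero => 
      convert measure_empty (μ := μ)
      ext x; simp
    | succ n ih =>
      have e := hX.measure_pair n (n + 1) {a} {a}ᶜ
      simp only [Set.mem_singleton_iff, Set.mem_compl_iff, add_sub_cancel_left] at e
      refine measure_mono_null (t := {x | x 0 = a ∧ x (n : ℤ) ≠ a} ∪
        {x | x (n : ℤ) = a ∧ ¬ x ((n : ℤ) + 1) = a}) (fun x hx => ?_)
        (measure_union_null ih (e.trans hstep))
      by_cases h : x (n : ℤ) = a
      · exact Or.inr ⟨h, by simpa using hx.2⟩
      · exact Or.inl ⟨hx.1, h⟩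
  obtain ⟨b, hb⟩ := exists_ne a
  obtain ⟨n, _, hn⟩ := hX.irreducible a b
  refine hn.ne' (measure_mono_null (fun x hx => ?_) (hall n))
  exact ⟨hx.1, fun h => hb (hx.2.symm.trans h)⟩

theorem exists_return_bound (hX : IsAperiodicMarkov μ) (a b : A) :
    ∃ n : ℕ, 0 < n ∧ ∃ κ : ℝ, 0 < κ ∧ κ ≤ 1 ∧ ∀ m C, PastEvent m C →
      μ.real (C ∩ {x | x m = b} ∩ {x | x (m + n) = a}) = κ * μ.real (C ∩ {x | x m = b}) := by
  have := hX.isProbabilityMeasure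
  obtain ⟨n, hn0, hn⟩ := hX.irreducible b a
  -- Only the last of the `n` coordinates is constrained.
  obtain ⟨κ, hκ⟩ := hX.exists_future n (fun t => {z | t + 1 = n → z = a}) b
  have e : ∀ m : ℤ, {x : ℤ → A | ∀ t < n, x (m + 1 + (t : ℕ)) ∈ {z | t + 1 = n → z = a}} =
      {x | x (m + n) = a} := by
    intro m
    ext x
    simp only [Set.mem_ofPred_eq]
    constructor
    · intro h
      have := h (n - 1) (by omega) (by omega)
      rwa [show m + 1 + ((n - 1 : ℕ) : ℤ) = m + n by omega] at this
    · intro h t ht htn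
      rwa [show m + 1 + (t : ℤ) = m + n by omega]
  have h0 := hκ 0 Set.univ PastEvent.univ
  rw [e, Set.univ_inter, zero_add] at h0
  have hb : 0 < μ.real {x | x 0 = b} :=
    ENNReal.toReal_pos (hX.measure_state_pos b).ne' (measure_ne_top _ _)
  have hpos : 0 < μ.real ({x | x 0 = b} ∩ {x | x (n : ℤ) = a}) :=
    ENNReal.toReal_pos hn.ne' (measure_ne_top _ _)
  have hle : μ.real ({x | x 0 = b} ∩ {x | x (n : ℤ) = a}) ≤ μ.real {x | x 0 = b} :=
    measureReal_mono Set.inter_subset_left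
  refine ⟨n, hn0, κ, ?_, ?_, fun m C hC => ?_⟩
  · rw [h0] at hpos
    exact pos_of_mul_pos_left hpos hb.le
  · rw [h0] at hle
    nlinarith
  · rw [← e]; exact hκ m C hC

/-- Since `A` is finite, the longest of the return times and the smallest of the return
probabilities serve for every present state. -/
theorem exists_avoidanceBound (hX : IsAperiodicMarkov μ) (a : A) :
    ∃ (N : ℕ) (δ : ℝ), 0 < δ ∧ δ ≤ 1 ∧
      AvoidanceBound μ (fun i => {x | x i = a}) N (1 - δ) := by
  have := hX.isProbabilityMeasure
  have := Fintype.ofFinite A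
  have : Nonempty A := ⟨a⟩
  choose n hn0 κ hκ0 hκ1 hκ using fun b => hX.exists_return_bound a b
  obtain ⟨b₀, hb₀⟩ := Finite.exists_min κ
  obtain ⟨b₁, hb₁⟩ := Finite.exists_max n
  refine ⟨n b₁, κ b₀, hκ0 b₀, hκ1 b₀, fun m C hC => ?_⟩
  rw [measureReal_eq_sum_inter μ (measurable_pi_apply m),
    measureReal_eq_sum_inter μ (measurable_pi_apply m) C, Finset.mul_sum]
  refine Finset.sum_le_sum fun b _ => ?_
  have hpb : PastEvent m (C ∩ {x | x m = b}) := hC.inter (PastEvent.coord le_rfl {b})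
  have hpa : PastEvent (m + n b) {x : ℤ → A | x (m + n b) = a} := PastEvent.coord le_rfl {a}
  have h1 := measureReal_inter_add_sdiff (μ := μ) (s := C ∩ {x | x m = b}) hpa.measurableSet
  rw [hκ b m C hC] at h1
  have h2 : μ.real (C \ hitSet (fun i => {x | x i = a}) m (n b₁) ∩ (fun x => x m) ⁻¹' {b}) ≤
      μ.real ((C ∩ {x | x m = b}) \ {x | x (m + n b) = a}) := by
    refine measureReal_mono ?_
    rintro x ⟨⟨hxC, hx⟩, hxb⟩
    exact ⟨⟨hxC, hxb⟩, fun h => hx ⟨n b, hn0 b, hb₁ b, h⟩⟩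
  have h3 : κ b₀ * μ.real (C ∩ {x | x m = b}) ≤ κ b * μ.real (C ∩ {x | x m = b}) :=
    mul_le_mul_of_nonneg_right (hb₀ b) measureReal_nonneg
  change _ ≤ (1 - κ b₀) * μ.real (C ∩ {x | x m = b})
  linarith

theorem measurable_stateDistribution (a : A) :
    Measurable (stateDistribution a : (ℤ → A) → (ℤ → Bool)) :=
  measurable_pi_lambda _ fun i => by
    classical
    exact (measurable_of_finite fun z : A => decide (z = a)).comp (measurable_pi_apply i)

/-- One of the finitely many words seen on the way to a random return has positive probability. It
ends in `a`, so it can be repeated independently; its probability is below `1` because the return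
itself may fail. -/
theorem exists_word [Nontrivial A] (hX : IsAperiodicMarkov μ) (a : A) :
    ∃ (ℓ : ℕ) (v : ℕ → Bool) (p : ℝ), 0 < ℓ ∧ v (ℓ - 1) = true ∧ 0 < p ∧ p < 1 ∧
      ∀ m C, PastEvent m C →
        μ.real (C ∩ {x | x m = a} ∩
          {x | ∀ t < ℓ, stateDistribution a x (m + 1 + (t : ℕ)) = v t}) =
          p * μ.real (C ∩ {x | x m = a}) := by
  classical
  have := hX.isProbabilityMeasure
  obtain ⟨ℓ, hℓ0, hret, hnot⟩ := hX.exists_random_return a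
  obtain ⟨v, hv⟩ : ∃ v : Fin ℓ → Bool, μ ({x | x 0 = a ∧ x (ℓ : ℤ) = a} ∩
      {x | ∀ t : Fin ℓ, stateDistribution a x (1 + (t : ℕ)) = v t}) ≠ 0 := by
    by_contra! H
    refine hret.ne' (measure_mono_null (fun x hx => ?_) (measure_iUnion_null H))
    exact Set.mem_iUnion.2 ⟨fun t => stateDistribution a x (1 + (t : ℕ)), hx, fun _ => rfl⟩
  let w : ℕ → Bool := fun t => if h : t < ℓ then v ⟨t, h⟩ else true
  obtain ⟨p, hp⟩ := hX.exists_future ℓ (fun t => {z | decide (z = a) = w t}) a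
  have e : ∀ m : ℤ, {x : ℤ → A | ∀ t < ℓ, stateDistribution a x (m + 1 + (t : ℕ)) = w t} =
      {x : ℤ → A | ∀ t < ℓ, x (m + 1 + (t : ℕ)) ∈ {z | decide (z = a) = w t}} := fun m => by
    ext x; simp [stateDistribution]
  have hlast : w (ℓ - 1) = true := by
    obtain ⟨x, ⟨_, hx⟩, hxv⟩ := nonempty_of_measure_ne_zero hv
    have h : ℓ - 1 < ℓ := by omega
    have h1 := hxv ⟨ℓ - 1, h⟩
    simp only [w, h, dif_pos]
    rw [← h1, show (1 : ℤ) + ((ℓ - 1 : ℕ) : ℤ) = ℓ by omega]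
    simpa [stateDistribution] using hx
  have h0 := hp 0 Set.univ PastEvent.univ
  rw [← e, Set.univ_inter, zero_add] at h0
  have hb : 0 < μ.real {x | x 0 = a} :=
    ENNReal.toReal_pos (hX.measure_state_pos a).ne' (measure_ne_top _ _)
  refine ⟨ℓ, w, p, hℓ0, hlast, ?_, ?_, fun m C hC => by rw [e]; exact hp m C hC⟩
  · have : 0 < μ.real ({x | x 0 = a} ∩
        {x | ∀ t < ℓ, stateDistribution a x (1 + (t : ℕ)) = w t}) := by
      refine (ENNReal.toReal_pos hv (measure_ne_top _ _)).trans_le (measureReal_mono ?_)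
      rintro x ⟨⟨hx, _⟩, hxv⟩
      refine ⟨hx, fun t ht => ?_⟩
      simpa [w, ht] using hxv ⟨t, ht⟩
    rw [h0] at this
    exact pos_of_mul_pos_left this hb.le
  · have h1 : μ.real ({x | x 0 = a} ∩ {x | ∀ t < ℓ, stateDistribution a x (1 + (t : ℕ)) = w t})
        ≤ μ.real ({x | x 0 = a} ∩ {x | x (ℓ : ℤ) = a}) := by
      refine measureReal_mono ?_
      rintro x ⟨hx, hxv⟩
      refine ⟨hx, ?_⟩
      have := hxv (ℓ - 1) (by omega)
      rw [hlast, show (1 : ℤ) + ((ℓ - 1 : ℕ) : ℤ) = ℓ by omega] at this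
      simpa [stateDistribution] using this
    have h2 := measureReal_inter_add_sdiff (μ := μ) (s := {x | x 0 = a})
      (PastEvent.measurableSet (PastEvent.coord le_rfl {a} :
        PastEvent (ℓ : ℤ) {x : ℤ → A | x (ℓ : ℤ) ∈ ({a} : Set A)}))
    have h3 : 0 < μ.real ({x | x 0 = a} \ {x | x (ℓ : ℤ) ∈ ({a} : Set A)}) :=
      ENNReal.toReal_pos hnot.ne' (measure_ne_top _ _)
    simp only [Set.mem_singleton_iff] at h2 h3
    rw [h0] at h1
    nlinarith

theorem exists_isRecurrentLaw [Nontrivial A] (hX : IsAperiodicMarkov μ) (a : A) :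
    ∃ v ℓ p δ N, IsRecurrentLaw (μ.map (stateDistribution a)) v ℓ p δ N := by
  have := hX.isProbabilityMeasure
  obtain ⟨ℓ, v, p, hℓ, hv, hp0, hp1, hp⟩ := hX.exists_word a
  obtain ⟨N, δ, hδ0, hδ1, hδ⟩ := hX.exists_avoidanceBound a
  have hm := measurable_stateDistribution a
  have hmap : ∀ {m : ℤ} {C : Set (ℤ → Bool)}, PastEvent m C →
      (μ.map (stateDistribution a)).real C = μ.real (stateDistribution a ⁻¹' C) :=
    fun hC => map_measureReal_apply hm hC.measurableSet
  have htrue : ∀ m : ℤ, PastEvent m {y : ℤ → Bool | y m = true} :=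
    fun m => PastEvent.coord le_rfl {true}
  refine ⟨v, ℓ, p, δ, N, Measure.isProbabilityMeasure_map hm.aemeasurable, ?_, hℓ, hv, hp0, hp1,
    fun m C hC => ?_, hδ0, hδ1, fun m C hC => ?_⟩
  · refine ⟨measurable_pi_lambda _ fun _ => measurable_pi_apply _, ?_⟩
    have hs : Measurable (shift : (ℤ → Bool) → (ℤ → Bool)) :=
      measurable_pi_lambda _ fun _ => measurable_pi_apply _
    rw [Measure.map_map hs hm]
    conv_rhs => rw [← hX.stationary.map_eq]
    rw [Measure.map_map hm hX.stationary.measurable]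
    rfl
  · have hw : PastEvent (m + ℓ) {y : ℤ → Bool | ∀ t < ℓ, y (m + 1 + (t : ℕ)) = v t} :=
      PastEvent.forall_lt ℓ (G := fun t => {y : ℤ → Bool | y (m + 1 + (t : ℕ)) = v t})
        fun t ht => PastEvent.coord (by omega) {v t}
    have h1 := hC.inter (htrue m)
    rw [hmap h1, hmap ((h1.mono (by omega)).inter hw)]
    have h2 := hp m _ (hC.preimage_stateDistribution a)
    have e : stateDistribution a ⁻¹' {y : ℤ → Bool | y m = true} = {x | x m = a} := by
      ext x; simp [stateDistribution]
    rw [Set.preimage_inter, Set.preimage_inter, e]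
    exact h2
  · have e : stateDistribution a ⁻¹' (hitSet (fun i => {y : ℤ → Bool | y i = true}) m N) =
        hitSet (fun i => {x | x i = a}) m N := by
      ext x; simp [stateDistribution, hitSet]
    have hh : MeasurableSet (hitSet (fun i => {y : ℤ → Bool | y i = true}) m N) := by
      have : hitSet (fun i => {y : ℤ → Bool | y i = true}) m N =
          ⋃ t : ℕ, ⋃ (_ : 1 ≤ t ∧ t ≤ N), {y | y (m + t) = true} := by
        ext y; simp [hitSet, and_assoc]
      rw [this]
      exact MeasurableSet.iUnion fun t => MeasurableSet.iUnion fun _ => (htrue _).measurableSet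
    rw [hmap hC, map_measureReal_apply hm (hC.measurableSet.diff hh), Set.preimage_sdiff, e]
    exact hδ m _ (hC.preimage_stateDistribution a)

end IsAperiodicMarkov

/-! ### Hitting estimates uniform in the past -/

section Hitting

variable {B : Type*} {G : ℤ → Set (ℤ → B)} {m : ℤ} {M : ℕ}

theorem hitSet_mono {M' : ℕ} (h : M ≤ M') : hitSet G m M ⊆ hitSet G m M' :=
  fun _ ⟨t, h1, h2, h3⟩ => ⟨t, h1, h2.trans h, h3⟩

theorem hitSet_zero : hitSet G m 0 = ∅ := by
  rw [Set.eq_empty_iff_forall_notMem]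
  rintro y ⟨t, h1, h2, _⟩
  omega

theorem hitSet_succ : hitSet G m (M + 1) = hitSet G m M ∪ G (m + (M + 1 : ℕ)) := by
  ext y
  constructor
  · rintro ⟨t, h1, h2, h3⟩
    rcases h2.lt_or_eq with h | rfl
    · exact Or.inl ⟨t, h1, by omega, h3⟩
    · exact Or.inr h3
  · rintro (h | h)
    · exact hitSet_mono (Nat.le_succ M) h
    · exact ⟨M + 1, by omega, le_rfl, h⟩

theorem PastEvent.hitSet (hG : ∀ i, PastEvent i (G i)) (m : ℤ) (M : ℕ) :
    PastEvent (m + M) (hitSet G m M) := by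
  induction M with
  | zero => rw [hitSet_zero]; simpa using (PastEvent.univ (B := B) (m := m)).compl
  | succ M ih =>
    rw [hitSet_succ, Set.union_eq_compl_compl_inter_compl]
    exact (((ih.mono (by push_cast; omega)).compl).inter (hG _).compl).compl

theorem AvoidanceBound.mono [MeasurableSpace B] {ν : Measure (ℤ → B)} [IsFiniteMeasure ν]
    {κ κ' : ℝ} {M' : ℕ} (h : AvoidanceBound ν G M κ) (hM : M ≤ M') (hκ : κ ≤ κ') :
    AvoidanceBound ν G M' κ' := fun m C hC =>
  calc ν.real (C \ _root_.hitSet G m M') ≤ ν.real (C \ _root_.hitSet G m M) :=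
        measureReal_mono (Set.sdiff_subset_sdiff_right (hitSet_mono hM))
    _ ≤ κ * ν.real C := h m C hC
    _ ≤ κ' * ν.real C := mul_le_mul_of_nonneg_right hκ measureReal_nonneg

/-- Avoiding the first blocks is itself an event of the past, so the bound applies afresh to the
next block. -/
theorem AvoidanceBound.iterate [MeasurableSpace B] {ν : Measure (ℤ → B)} [IsFiniteMeasure ν]
    {κ : ℝ} (hκ : 0 ≤ κ) (hG : ∀ i, PastEvent i (G i)) (h : AvoidanceBound ν G M κ) (n : ℕ) :
    AvoidanceBound ν G (n * M) (κ ^ n) := by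
  induction n with
  | zero => exact fun m C _ => by simpa using measureReal_mono Set.sdiff_subset
  | succ n ih =>
    intro m C hC
    have hp : PastEvent (m + (n * M : ℕ)) (C \ _root_.hitSet G m (n * M)) :=
      (hC.mono (by omega)).diff (PastEvent.hitSet hG m _)
    calc ν.real (C \ _root_.hitSet G m ((n + 1) * M))
        ≤ ν.real ((C \ _root_.hitSet G m (n * M)) \
            _root_.hitSet G (m + (n * M : ℕ)) M) := by
          refine measureReal_mono ?_
          rintro y ⟨hy, hn⟩
          refine ⟨⟨hy, fun h => hn (hitSet_mono (by rw [add_mul]; omega) h)⟩, ?_⟩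
          rintro ⟨t, h1, h2, h3⟩
          refine hn ⟨n * M + t, by omega, by rw [add_mul]; omega, ?_⟩
          rwa [show m + ((n * M + t : ℕ) : ℤ) = m + (n * M : ℕ) + t by push_cast; ring]
      _ ≤ κ * (κ ^ n * ν.real C) :=
          (h _ _ hp).trans (mul_le_mul_of_nonneg_left (ih m C hC) hκ)
      _ = κ ^ (n + 1) * ν.real C := by ring

/-- Decomposition by the first hit of `G`: up to that time everything is past, so `E` follows with
the factor `q`. The event `E i` may involve the future of `i`. -/
theorem mul_measureReal_hitSet_le [Finite B] [MeasurableSpace B] [DiscreteMeasurableSpace B]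
    {ν : Measure (ℤ → B)} [IsFiniteMeasure ν] (hG : ∀ i, PastEvent i (G i))
    {E : ℤ → Set (ℤ → B)} (hE : ∀ i, MeasurableSet (E i)) {q : ℝ}
    (hq : ∀ i D, PastEvent i D → D ⊆ G i → q * ν.real D ≤ ν.real (D ∩ E i))
    {C : Set (ℤ → B)} (hC : PastEvent m C) (M : ℕ) :
    q * ν.real (C ∩ hitSet G m M) ≤ ν.real (C ∩ hitSet (fun i => G i ∩ E i) m M) := by
  -- `V` collects the outcomes for which `E` holds at the first hit; these pieces are disjoint, so
  -- their measures add.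
  obtain ⟨V, _, hV, hVq⟩ : ∃ V, MeasurableSet V ∧
      V ⊆ C ∩ hitSet G m M ∩ hitSet (fun i => G i ∩ E i) m M ∧
      q * ν.real (C ∩ hitSet G m M) ≤ ν.real V := by
    induction M with
    | zero => exact ⟨∅, MeasurableSet.empty, Set.empty_subset _, by simp [hitSet_zero]⟩
    | succ M ih =>
      obtain ⟨V, hVm, hV, hVq⟩ := ih
      have hhit : PastEvent (m + M) (hitSet G m M) := PastEvent.hitSet hG m M
      have hD : PastEvent (m + (M + 1 : ℕ)) ((C ∩ G (m + (M + 1 : ℕ))) \ hitSet G m M) :=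
        ((hC.mono (by omega)).inter (hG _)).diff (hhit.mono (by push_cast; omega))
      set D := (C ∩ G (m + (M + 1 : ℕ))) \ hitSet G m M with hDdef
      refine ⟨V ∪ (D ∩ E (m + (M + 1 : ℕ))), hVm.union (hD.measurableSet.inter (hE _)), ?_, ?_⟩
      · rw [hitSet_succ, hitSet_succ]
        rintro y (hy | hy)
        · exact ⟨⟨(hV hy).1.1, Or.inl (hV hy).1.2⟩, Or.inl (hV hy).2⟩
        · exact ⟨⟨hy.1.1.1, Or.inr hy.1.1.2⟩, Or.inr ⟨hy.1.1.2, hy.2⟩⟩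
      · have e : C ∩ hitSet G m (M + 1) = (C ∩ hitSet G m M) ∪ D := by
          ext y
          rw [hitSet_succ, hDdef]
          simp only [Set.mem_inter_iff, Set.mem_union, Set.mem_sdiff]
          tauto
        rw [e, measureReal_union (Set.disjoint_left.2 fun y h1 h2 => h2.2 h1.2)
          hD.measurableSet, measureReal_union
          (Set.disjoint_left.2 fun y h1 h2 => h2.1.2 (hV h1).1.2)
          (hD.measurableSet.inter (hE _)), mul_add]
        exact add_le_add hVq (hq _ _ hD fun y hy => hy.1.2)
  exact hVq.trans (measureReal_mono fun y hy => ⟨(hV hy).1.1, (hV hy).2⟩)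

end Hitting

/-! ### Repeated words and thinning -/

/-- The event that the word `v 0, …, v (ℓ - 1)`, repeated `k` times and preceded by `true`, ends
at `j`. -/
def wordPower (v : ℕ → Bool) (ℓ : ℕ) : ℕ → ℤ → Set (ℤ → Bool)
  | 0, j => {y | y j = true}
  | k + 1, j => wordPower v ℓ k (j - ℓ) ∩ {y | ∀ t < ℓ, y (j - ℓ + 1 + (t : ℕ)) = v t}

/-- `G i` is determined by the coordinates in `[i - ρ, i]`. -/
def IsLocal {B : Type*} (ρ : ℕ) (G : ℤ → Set (ℤ → B)) : Prop :=
  ∀ (i : ℤ) (x x' : ℤ → B), (∀ j, i - ρ ≤ j → j ≤ i → x j = x' j) → x ∈ G i → x' ∈ G i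

/-- `G` is defined in the same way at all coordinates. -/
def IsEquivariant {B : Type*} (G : ℤ → Set (ℤ → B)) : Prop :=
  ∀ i y, shift y ∈ G i ↔ y ∈ G (i + 1)

/-- `S` occurs at `i`, and `P` occurs in `[i - R, i]`. -/
def candidate {B : Type*} (S P : ℤ → Set (ℤ → B)) (R : ℕ) (i : ℤ) : Set (ℤ → B) :=
  {y | y ∈ S i ∧ ∃ t : ℕ, t ≤ R ∧ y ∈ P (i - t)}

/-- `i` is a candidate, and there is no candidate in `[i - R, i)`. -/
def thinning {B : Type*} (S P : ℤ → Set (ℤ → B)) (R : ℕ) (i : ℤ) : Set (ℤ → B) :=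
  {y | y ∈ candidate S P R i ∧ ∀ t : ℕ, 1 ≤ t → t ≤ R → y ∉ candidate S P R (i - t)}

theorem IsLocal.pastEvent {B : Type*} {ρ : ℕ} {G : ℤ → Set (ℤ → B)} (h : IsLocal ρ G) (i : ℤ) :
    PastEvent i (G i) := ⟨i - ρ, h i⟩

theorem IsLocal.mono {B : Type*} {ρ ρ' : ℕ} {G : ℤ → Set (ℤ → B)} (h : IsLocal ρ G)
    (hρ : ρ ≤ ρ') : IsLocal ρ' G :=
  fun i x x' hx => h i x x' fun j h1 h2 => hx j (by omega) h2

theorem IsLocal.candidate {B : Type*} {S P : ℤ → Set (ℤ → B)} {R : ℕ} (hS : IsLocal (2 * R) S)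
    (hP : IsLocal R P) : IsLocal (2 * R) (candidate S P R) := by
  rintro i x x' hx ⟨h1, t, ht, h2⟩
  exact ⟨hS i x x' hx h1, t, ht,
    hP _ x x' (fun j h1 h2 => hx j (by push_cast; omega) (by omega)) h2⟩

/-- The candidates consulted lie within `R`, and each looks back at most `2 * R`. The range does not
accumulate along a chain of rejections. -/
theorem IsLocal.thinning {B : Type*} {S P : ℤ → Set (ℤ → B)} {R : ℕ} (hS : IsLocal (2 * R) S)
    (hP : IsLocal R P) : IsLocal (3 * R) (thinning S P R) := by
  have hc := hS.candidate hP
  rintro i x x' hx ⟨h1, h2⟩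
  refine ⟨hc i x x' (fun j h1 h2 => hx j (by push_cast at *; omega) h2) h1,
    fun t ht htR h => h2 t ht htR (hc _ x' x (fun j h1 h2 => (hx j ?_ ?_).symm) h)⟩ <;>
  push_cast at * <;> omega

theorem IsEquivariant.thinning {B : Type*} {S P : ℤ → Set (ℤ → B)} {R : ℕ}
    (hS : IsEquivariant S) (hP : IsEquivariant P) : IsEquivariant (thinning S P R) := by
  have hc : IsEquivariant (candidate S P R) := by
    intro i y
    simp only [candidate, Set.mem_ofPred_eq]
    rw [hS i y]
    refine and_congr_right fun _ => exists_congr fun t => and_congr_right fun _ => ?_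
    rw [hP, show i - (t : ℤ) + 1 = i + 1 - t by ring]
  intro i y
  simp only [_root_.thinning, Set.mem_ofPred_eq]
  rw [hc i y]
  refine and_congr_right fun _ => forall_congr' fun t => ?_
  rw [hc, show i - (t : ℤ) + 1 = i + 1 - t by ring]

theorem thinning_subset {B : Type*} {S P : ℤ → Set (ℤ → B)} {R : ℕ} {i : ℤ} :
    thinning S P R i ⊆ S i := fun _ h => h.1.1

theorem thinning_separated {B : Type*} {S P : ℤ → Set (ℤ → B)} {R : ℕ} {i j : ℤ} {y : ℤ → B}
    (hi : y ∈ thinning S P R i) (hj : y ∈ thinning S P R j) (hij : i < j) : i + R < j := by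
  by_contra! h
  refine hj.2 (j - i).toNat (by omega) (by omega) ?_
  rw [show j - ((j - i).toNat : ℤ) = i by omega]
  exact hi.1

/-- The first candidate after `m + K + 2 * R` is kept: a candidate at most `R` before it would lie
at or before that point, hence would need an occurrence of `P` in the stretch of length `2 * R` that
has none. -/
theorem mem_hitSet_thinning {B : Type*} {S P : ℤ → Set (ℤ → B)} {R K M : ℕ} {m : ℤ} {y : ℤ → B}
    (h1 : y ∉ hitSet P (m + K) (2 * R))
    (h2 : y ∈ hitSet (fun i => P i ∩ hitSet S i R) (m + K + (2 * R : ℕ)) M) :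
    y ∈ hitSet (thinning S P R) m (K + 3 * R + M) := by
  classical
  obtain ⟨t, ht1, htM, hP, s, hs1, hsR, hS⟩ := h2
  set m' : ℤ := m + K + (2 * R : ℕ) with hm'
  have hex : ∃ u : ℕ, 1 ≤ u ∧ y ∈ candidate S P R (m' + u) := by
    refine ⟨t + s, by omega, ?_, s, hsR, ?_⟩
    · rwa [show m' + ((t + s : ℕ) : ℤ) = m' + t + s by push_cast; ring]
    · rwa [show m' + ((t + s : ℕ) : ℤ) - s = m' + t by push_cast; ring]
  have hle : Nat.find hex ≤ t + s := by
    refine Nat.find_min' hex ⟨by omega, ?_, s, hsR, ?_⟩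
    · rwa [show m' + ((t + s : ℕ) : ℤ) = m' + t + s by push_cast; ring]
    · rwa [show m' + ((t + s : ℕ) : ℤ) - s = m' + t by push_cast; ring]
  obtain ⟨hu1, hu⟩ := Nat.find_spec hex
  have hmin : ∀ u' : ℕ, 1 ≤ u' → u' < Nat.find hex → y ∉ candidate S P R (m' + u') :=
    fun u' h1 h2 h3 => Nat.find_min hex h2 ⟨h1, h3⟩
  generalize Nat.find hex = u at hle hu1 hu hmin
  refine ⟨K + 2 * R + u, by omega, by omega, ?_⟩
  rw [show m + ((K + 2 * R + u : ℕ) : ℤ) = m' + u by rw [hm']; push_cast; ring]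
  refine ⟨hu, fun t' ht1' htR' hc => ?_⟩
  by_cases h : t' < u
  · refine hmin (u - t') (by omega) (by omega) ?_
    rwa [show m' + ((u - t' : ℕ) : ℤ) = m' + u - t' by omega]
  · obtain ⟨_, s', hs', hP'⟩ := hc
    refine h1 ⟨(2 * R + u) - t' - s', by omega, by omega, ?_⟩
    rwa [show m + (K : ℤ) + (((2 * R + u) - t' - s' : ℕ) : ℤ) = m' + u - t' - s' by omega]

/-- The three favourable events, no `P` for a time `2 * R`, then `P` within `M`, then `S` within
`R`, contribute the factors `1 / 2`, `1 - κ` and `1 / 2`. -/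
theorem AvoidanceBound.thinning {B : Type*} [Finite B] [MeasurableSpace B]
    [DiscreteMeasurableSpace B] {ν : Measure (ℤ → B)} [IsFiniteMeasure ν]
    {S P : ℤ → Set (ℤ → B)} {R K M : ℕ} {κ : ℝ}
    (hS : ∀ i, PastEvent i (S i)) (hP : ∀ i, PastEvent i (P i))
    (hSR : AvoidanceBound ν S R (1 / 2)) (hPM : AvoidanceBound ν P M κ) (hκ : κ ≤ 1)
    (hPK : ∀ m C, PastEvent m C → ν.real (C ∩ hitSet P (m + K) (2 * R)) ≤ 1 / 2 * ν.real C) :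
    AvoidanceBound ν (thinning S P R) (K + 3 * R + M) (1 - (1 - κ) / 4) := by
  intro m C hC
  have hh : PastEvent (m + K + (2 * R : ℕ)) (hitSet P (m + K) (2 * R)) := PastEvent.hitSet hP _ _
  have hD : PastEvent (m + K + (2 * R : ℕ)) (C \ hitSet P (m + K) (2 * R)) :=
    (hC.mono (by omega)).diff hh
  have hhS : ∀ i, MeasurableSet (hitSet S i R) := fun i => (PastEvent.hitSet hS i R).measurableSet
  have h1 := measureReal_inter_add_sdiff (μ := ν) (s := C) hh.measurableSet
  have h2 := hPK m C hC
  set D := C \ hitSet P (m + K) (2 * R) with hDdef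
  have h3 := hPM _ D hD
  have h4 := measureReal_inter_add_sdiff (μ := ν) (s := D)
    (PastEvent.hitSet hP (m + K + (2 * R : ℕ)) M).measurableSet
  have h5 := mul_measureReal_hitSet_le (ν := ν) (q := 1 / 2) hP hhS (fun i F hF _ => by
    have a1 := hSR i F hF
    have a2 := measureReal_inter_add_sdiff (μ := ν) (s := F) (hhS i)
    linarith) hD M
  set W := D ∩ hitSet (fun i => P i ∩ hitSet S i R) (m + K + (2 * R : ℕ)) M with hW
  have hWsub : C \ hitSet (_root_.thinning S P R) m (K + 3 * R + M) ⊆ C \ W := by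
    rintro y ⟨hy, hn⟩
    exact ⟨hy, fun h => hn (mem_hitSet_thinning h.1.2 h.2)⟩
  have hWm : MeasurableSet W := by
    have : ∀ M : ℕ, MeasurableSet
        (hitSet (fun i => P i ∩ hitSet S i R) (m + K + (2 * R : ℕ)) M) := by
      intro M
      induction M with
      | zero => rw [hitSet_zero]; exact MeasurableSet.empty
      | succ M ih => rw [hitSet_succ]; exact ih.union ((hP _).measurableSet.inter (hhS _))
    exact hD.measurableSet.inter (this M)
  have h6 := measureReal_mono (μ := ν) hWsub
  have h7 := measureReal_sdiff (μ := ν) (s₁ := C) (s₂ := W) (fun y hy => hy.1.1) hWm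
  have h8 : (1 - κ) * (ν.real C / 2) ≤ (1 - κ) * ν.real D :=
    mul_le_mul_of_nonneg_left (by linarith) (by linarith)
  linarith

/-! ### Probabilities of repeated words -/

section WordPower

variable {ν : Measure (ℤ → Bool)} {v : ℕ → Bool} {ℓ : ℕ} {p δ : ℝ} {N : ℕ}

theorem isLocal_wordPower (v : ℕ → Bool) (ℓ k : ℕ) : IsLocal (k * ℓ) (wordPower v ℓ k) := by
  induction k with
  | zero =>
    intro i x x' hx h
    have := hx i (by simp) le_rfl
    simpa [wordPower, ← this] using h
  | succ k ih =>
    rintro i x x' hx ⟨h1, h2⟩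
    refine ⟨ih _ x x' (fun j hj1 hj2 => hx j ?_ ?_) h1, fun t ht => ?_⟩
    · push_cast at *; linarith
    · omega
    · rw [← h2 t ht]
      refine (hx _ ?_ ?_).symm
      · push_cast
        have : (0 : ℤ) ≤ k * ℓ := by positivity
        linarith
      · omega

theorem isEquivariant_wordPower (v : ℕ → Bool) (ℓ k : ℕ) :
    IsEquivariant (wordPower v ℓ k) := by
  induction k with
  | zero => intro i y; simp [wordPower, shift]
  | succ k ih =>
    intro i y
    simp only [wordPower, Set.mem_inter_iff, ih (i - ℓ) y, Set.mem_ofPred_eq, shift]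
    rw [show i - (ℓ : ℤ) + 1 = i + 1 - ℓ by ring]
    refine and_congr_right fun _ => forall_congr' fun t => forall_congr' fun _ => ?_
    rw [show i + 1 - (ℓ : ℤ) + t + 1 = i + 1 - ℓ + 1 + t by ring]

namespace IsRecurrentLaw

theorem wordPower_subset (h : IsRecurrentLaw ν v ℓ p δ N) (k : ℕ) (j : ℤ) :
    wordPower v ℓ k j ⊆ {y | y j = true} := by
  have := h.length_pos
  cases k with
  | zero => exact subset_rfl
  | succ k =>
    rintro y ⟨_, hy⟩
    have h1 := hy (ℓ - 1) (by omega)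
    rw [h.last] at h1
    rwa [show j - (ℓ : ℤ) + 1 + ((ℓ - 1 : ℕ) : ℤ) = j by omega] at h1

theorem measureReal_wordPower (h : IsRecurrentLaw ν v ℓ p δ N) (k : ℕ) {m : ℤ}
    {C : Set (ℤ → Bool)} (hC : PastEvent m C) :
    ν.real (C ∩ wordPower v ℓ k (m + (k * ℓ : ℕ))) = p ^ k * ν.real (C ∩ {y | y m = true}) := by
  induction k with
  | zero => simp [wordPower]
  | succ k ih =>
    set j : ℤ := m + (k * ℓ : ℕ) with hj
    have e : m + (((k + 1) * ℓ : ℕ) : ℤ) - ℓ = j := by rw [hj]; push_cast; ring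
    have hD : PastEvent j (C ∩ wordPower v ℓ k j) :=
      (hC.mono (by omega)).inter ((isLocal_wordPower v ℓ k).pastEvent j)
    have e2 : C ∩ wordPower v ℓ k j ∩ {y | y j = true} = C ∩ wordPower v ℓ k j :=
      Set.inter_eq_left.2 fun y hy => h.wordPower_subset k j hy.2
    have h1 := h.word j _ hD
    rw [e2, ih] at h1
    rw [wordPower, e, ← Set.inter_assoc, h1]
    ring

/-- A union bound over the end points. The delay `k * ℓ` ensures that the counted words begin after
time `m`. -/
theorem measureReal_hitSet_wordPower_le (h : IsRecurrentLaw ν v ℓ p δ N) (k : ℕ) {m : ℤ}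
    {C : Set (ℤ → Bool)} (hC : PastEvent m C) (M : ℕ) :
    ν.real (C ∩ hitSet (wordPower v ℓ k) (m + (k * ℓ : ℕ)) M) ≤ M * p ^ k * ν.real C := by
  have := h.isProbabilityMeasure
  induction M with
  | zero => simp [hitSet_zero]
  | succ M ih =>
    rw [hitSet_succ, Set.inter_union_distrib_left]
    refine (measureReal_union_le _ _).trans ?_
    have h1 := h.measureReal_wordPower k (hC.mono (show m ≤ m + (M + 1 : ℕ) by omega))
    have h2 : ν.real (C ∩ {y | y (m + (M + 1 : ℕ)) = true}) ≤ ν.real C :=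
      measureReal_mono Set.inter_subset_left
    rw [add_right_comm, h1]
    have h3 := mul_le_mul_of_nonneg_left h2 (pow_pos h.p_pos k).le
    have h4 : ((M + 1 : ℕ) : ℝ) = M + 1 := by push_cast; ring
    rw [h4]
    linarith

/-- Wait at most `N` for a `true`, then let the word power follow it. -/
theorem avoidanceBound_wordPower (h : IsRecurrentLaw ν v ℓ p δ N) (k : ℕ) :
    AvoidanceBound ν (wordPower v ℓ k) (N + k * ℓ) (1 - δ * p ^ k) := by
  have := h.isProbabilityMeasure
  intro m C hC
  have hG : ∀ i : ℤ, PastEvent i {y : ℤ → Bool | y i = true} :=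
    fun i => PastEvent.coord le_rfl {true}
  have hP : ∀ i, PastEvent i (wordPower v ℓ k i) := (isLocal_wordPower v ℓ k).pastEvent
  have h1 := mul_measureReal_hitSet_le (ν := ν) (q := p ^ k) hG
    (E := fun i => wordPower v ℓ k (i + (k * ℓ : ℕ))) (fun i => (hP _).measurableSet)
    (fun i D hD hsub => by
      rw [h.measureReal_wordPower k hD, Set.inter_eq_left.2 hsub]) hC N
  have h2 := h.recurrent m C hC
  have h3 := measureReal_inter_add_sdiff (μ := ν) (s := C) (PastEvent.hitSet hG m N).measurableSet
  have h4 : C ∩ hitSet (fun i => {y | y i = true} ∩ wordPower v ℓ k (i + (k * ℓ : ℕ))) m N ⊆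
      C ∩ hitSet (wordPower v ℓ k) m (N + k * ℓ) := by
    rintro y ⟨hy, t, ht1, ht2, _, ht3⟩
    refine ⟨hy, t + k * ℓ, by omega, by omega, ?_⟩
    rwa [show m + ((t + k * ℓ : ℕ) : ℤ) = m + t + (k * ℓ : ℕ) by push_cast; ring]
  have h5 := measureReal_mono (μ := ν) h4
  have h6 := measureReal_inter_add_sdiff (μ := ν) (s := C)
    (PastEvent.hitSet hP m (N + k * ℓ)).measurableSet
  have h7 := mul_le_mul_of_nonneg_left
    (show δ * ν.real C ≤ ν.real (C ∩ hitSet (fun i => {y | y i = true}) m N) by linarith)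
    (pow_pos h.p_pos k).le
  linarith

end IsRecurrentLaw

end WordPower

/-! ### Choice of the word power and of the scale -/

theorem one_sub_pow_le {x : ℝ} {n : ℕ} (hx0 : 0 ≤ x) (hx1 : x ≤ 1) (hn : n * x ≤ 1) :
    (1 - x) ^ n ≤ 1 - n * x / 2 := by
  have h1 : 1 + n * x ≤ (1 + x) ^ n := one_add_mul_le_pow (by linarith) n
  have h2 : (1 - x) ^ n * (1 + x) ^ n ≤ 1 := by
    rw [← mul_pow]
    exact pow_le_one₀ (by nlinarith) (by nlinarith)
  have h3 : 0 ≤ (1 - x) ^ n := pow_nonneg (by linarith) n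
  have h0 : 0 ≤ n * x := by positivity
  have h4 : (1 - x) ^ n * (1 + n * x) ≤ 1 := (mul_le_mul_of_nonneg_left h1 h3).trans h2
  have h5 : 1 ≤ (1 - n * x / 2) * (1 + n * x) := by nlinarith
  exact le_of_mul_le_mul_right (h4.trans h5) (by linarith)

/-- The powers of `p` leave no gap wider than the factor `p`, so one of them is of order `1 / R`:
rare over a time `2 * R`, yet not much rarer. -/
theorem exists_pow_near {p : ℝ} (hp0 : 0 < p) (hp1 : p < 1) (R : ℕ) (hR : 8 ≤ R) :
    ∃ k : ℕ, (k : ℝ) ≤ 1 + 2 / Real.log p⁻¹ * Real.log R ∧ p ^ k ≤ 1 / (4 * (R + 1)) ∧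
      p / (8 * R) ≤ p ^ k := by
  have hR' : (8 : ℝ) ≤ R := by exact_mod_cast hR
  obtain ⟨n, hn1, hn2⟩ := exists_nat_pow_near_of_lt_one (x := 1 / (4 * ((R : ℝ) + 1)))
    (by positivity) (by rw [div_le_one (by positivity)]; linarith) hp0 hp1
  have hle : 1 / (8 * (R : ℝ)) ≤ p ^ n := by
    refine le_trans ?_ hn2
    exact one_div_le_one_div_of_le (by positivity) (by linarith)
  refine ⟨n + 1, ?_, hn1.le, ?_⟩
  · have hlog : 0 < Real.log p⁻¹ := Real.log_pos ((one_lt_inv₀ hp0).2 hp1)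
    have h1 := Real.log_le_log (by positivity) hle
    rw [Real.log_pow, one_div, Real.log_inv] at h1
    have h2 : Real.log (8 * R) ≤ 2 * Real.log R := by
      rw [Real.log_mul (by norm_num) (by positivity)]
      have := Real.log_le_log (by norm_num) hR'
      linarith
    have h3 : n * Real.log p⁻¹ ≤ 2 * Real.log R := by
      rw [Real.log_inv]; linarith
    have h4 : (n : ℝ) ≤ 2 / Real.log p⁻¹ * Real.log R := by
      rw [div_mul_eq_mul_div, le_div_iff₀ hlog]
      exact h3
    push_cast
    linarith
  · rw [pow_succ]
    calc p / (8 * R) = 1 / (8 * (R : ℝ)) * p := by ring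
      _ ≤ p ^ n * p := mul_le_mul_of_nonneg_right hle hp0.le

/-- A time `R` contains `n = R / Q` trials of length `Q = N + k * ℓ`, of order at most `log R`. Each
succeeds with probability at least `x = δ * p ^ k`, and `n * x` is at least a constant over `log R`.
-/
theorem IsRecurrentLaw.exists_scale {ν : Measure (ℤ → Bool)} {v : ℕ → Bool} {ℓ : ℕ} {p δ : ℝ}
    {N : ℕ} (h : IsRecurrentLaw ν v ℓ p δ N) :
    ∃ c : ℝ, 0 < c ∧ ∃ R₀ : ℕ, ∀ R ≥ R₀, ∃ k : ℕ, k * ℓ ≤ R ∧ ∀ S : ℤ → Set (ℤ → Bool),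
      (∀ i, PastEvent i (S i)) → AvoidanceBound ν S R (1 / 2) →
        AvoidanceBound ν (thinning S (wordPower v ℓ k) R) (5 * R) (1 - c / Real.log R) := by
  have := h.isProbabilityMeasure
  have hp0 := h.p_pos
  have hδ0 := h.δ_pos
  have hδ1 := h.δ_le_one
  have hℓ : (0 : ℝ) < ℓ := by exact_mod_cast h.length_pos
  have hlam : 0 < Real.log p⁻¹ := Real.log_pos ((one_lt_inv₀ hp0).2 h.p_lt_one)
  set D : ℝ := N + ℓ + 2 * ℓ / Real.log p⁻¹ with hD
  have hD0 : 0 < D := by positivity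
  obtain ⟨R₀, hR₀⟩ : ∃ R₀ : ℕ, ∀ R : ℕ, R₀ ≤ R → D * Real.log R ≤ R ∧ 1 ≤ Real.log R := by
    have h1 : ∀ᶠ x : ℝ in atTop, D * Real.log x ≤ x := by
      filter_upwards [Real.isLittleO_log_id_atTop.bound (c := 1 / D) (by positivity),
        eventually_ge_atTop 1] with x hx hx1
      rw [Real.norm_of_nonneg (Real.log_nonneg hx1), id, Real.norm_of_nonneg (by linarith),
        one_div, inv_mul_eq_div, le_div_iff₀ hD0] at hx
      linarith
    have h2 : ∀ᶠ x : ℝ in atTop, 1 ≤ Real.log x := Real.tendsto_log_atTop.eventually_ge_atTop 1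
    exact eventually_atTop.1 (tendsto_natCast_atTop_atTop.eventually (h1.and h2))
  refine ⟨δ * p / (256 * D), by positivity, max 8 R₀, fun R hR => ?_⟩
  have hR8 : 8 ≤ R := (le_max_left _ _).trans hR
  have hRpos : (8 : ℝ) ≤ R := by exact_mod_cast hR8
  obtain ⟨hDR, hlog⟩ := hR₀ R ((le_max_right _ _).trans hR)
  obtain ⟨k, hk, hpk1, hpk2⟩ := exists_pow_near hp0 h.p_lt_one R hR8
  set Q : ℕ := N + k * ℓ with hQ
  have hQD : (Q : ℝ) ≤ D * Real.log R := by
    have h1 : (k : ℝ) * ℓ ≤ (1 + 2 / Real.log p⁻¹ * Real.log R) * ℓ :=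
      mul_le_mul_of_nonneg_right hk hℓ.le
    have h2 : (N : ℝ) + ℓ ≤ (N + ℓ) * Real.log R := le_mul_of_one_le_right (by positivity) hlog
    calc (Q : ℝ) = N + k * ℓ := by rw [hQ]; push_cast; ring
      _ ≤ N + ℓ + 2 * ℓ / Real.log p⁻¹ * Real.log R := by
        have : (1 + 2 / Real.log p⁻¹ * Real.log R) * ℓ =
          ℓ + 2 * ℓ / Real.log p⁻¹ * Real.log R := by ring
        linarith
      _ ≤ D * Real.log R := by rw [hD, add_mul]; linarith
  have hQR : Q ≤ R := by exact_mod_cast hQD.trans hDR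
  have hQ0 : 0 < Q := by
    -- As `N` may be zero, `Q > 0` needs `k ≠ 0`, which holds because `p ^ 0` is not small.
    rcases Nat.eq_zero_or_pos k with rfl | hk0
    · exfalso
      rw [pow_zero, le_div_iff₀ (by positivity)] at hpk1
      linarith
    · have := Nat.mul_pos hk0 h.length_pos
      omega
  set n : ℕ := R / Q with hn
  have hnR : n * Q ≤ R := Nat.div_mul_le_self R Q
  have hn1 : 1 ≤ n := (Nat.one_le_div_iff hQ0).2 hQR
  have hn2 : R ≤ 2 * (n * Q) := by
    have h1 : R < n * Q + Q := Nat.lt_div_mul_add hQ0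
    have h2 : Q ≤ n * Q := Nat.le_mul_of_pos_left Q hn1
    omega
  set x : ℝ := δ * p ^ k with hx
  have hpk0 : 0 < p ^ k := pow_pos hp0 k
  have hx0 : 0 < x := by positivity
  have hxp : x ≤ p ^ k := mul_le_of_le_one_left hpk0.le hδ1
  have hRx : (R : ℝ) * x ≤ 1 / 4 := by
    calc (R : ℝ) * x ≤ R * (1 / (4 * (R + 1))) :=
          mul_le_mul_of_nonneg_left (hxp.trans hpk1) (by positivity)
      _ ≤ 1 / 4 := by
          rw [mul_one_div, div_le_div_iff₀ (by positivity) (by positivity)]; linarith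
  have hnx : (n : ℝ) * x ≤ 1 := by
    have : (n : ℝ) ≤ R := by exact_mod_cast Nat.div_le_self R Q
    nlinarith
  have hx1 : x ≤ 1 := by nlinarith
  have hnx' : δ * p / (16 * (D * Real.log R)) ≤ n * x := by
    have hR2 : (R : ℝ) ≤ 2 * (n * Q) := by exact_mod_cast hn2
    have hx2 : δ * (p / (8 * R)) ≤ x := mul_le_mul_of_nonneg_left hpk2 hδ0.le
    have h1 : (R : ℝ) ≤ 2 * (n * (D * Real.log R)) :=
      hR2.trans (by gcongr)
    rw [div_le_iff₀ (by positivity)]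
    calc δ * p = δ * (p / (8 * R)) * 8 * R := by field_simp
      _ ≤ x * 8 * R := by gcongr
      _ ≤ x * 8 * (2 * (n * (D * Real.log R))) := by gcongr
      _ = n * x * (16 * (D * Real.log R)) := by ring
  have hP : ∀ i, PastEvent i (wordPower v ℓ k i) := (isLocal_wordPower v ℓ k).pastEvent
  have hav : AvoidanceBound ν (wordPower v ℓ k) R (1 - n * x / 2) :=
    ((h.avoidanceBound_wordPower k).iterate (by linarith) hP n).mono hnR
      (one_sub_pow_le hx0.le hx1 hnx)
  refine ⟨k, by omega, fun S hS hSR => ?_⟩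
  have hT := AvoidanceBound.thinning (K := k * ℓ) hS hP hSR hav (by nlinarith)
    fun m C hC => (h.measureReal_hitSet_wordPower_le k hC (2 * R)).trans <| by
      refine mul_le_mul_of_nonneg_right ?_ measureReal_nonneg
      calc ((2 * R : ℕ) : ℝ) * p ^ k ≤ (2 * R) * (1 / (4 * (R + 1))) := by
            push_cast
            exact mul_le_mul_of_nonneg_left hpk1 (by positivity)
        _ ≤ 1 / 2 := by
            rw [mul_one_div, div_le_div_iff₀ (by positivity) (by positivity)]; linarith
  refine hT.mono (by omega) ?_
  have : δ * p / (256 * D) / Real.log R = δ * p / (16 * (D * Real.log R)) / 16 := by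
    field_simp; norm_num
  rw [this]
  have h0 : 0 < δ * p / (16 * (D * Real.log R)) := by positivity
  linarith

/-- The distance that marks of rank `r` keep when the size of `r`-skeletons is at most `L`. -/
noncomputable def scale (L : ℝ) : ℕ := ⌊L / Real.log L ^ 4⌋₊

/-- With `l = log L`, there are `n = ⌊l ^ 3⌋₊` blocks of length `5 * scale L`. They last at most `5
* L / l`, and all fail with probability at most `(1 - c / l) ^ n`, of order at most `exp (-(c / 2) *
l ^ 2)`. -/
theorem exists_scale_threshold {c : ℝ} (hc : 0 < c) (R₀ : ℕ) :
    ∃ Λ : ℝ, ∀ L ≥ Λ, 2 ≤ L ∧ 2 ≤ Real.log L ∧ R₀ ≤ scale L ∧ (scale L : ℝ) ≤ L / 12 ∧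
      ∃ n : ℕ, ((n * (5 * scale L) : ℕ) : ℝ) ≤ L / 4 ∧ 0 ≤ 1 - c / Real.log (scale L) ∧
        (1 - c / Real.log (scale L)) ^ n ≤ Real.exp (-(c / 2) * Real.log L ^ 2) ∧
        Real.exp (-(c / 2) * Real.log L ^ 2) ≤ 1 / 2 := by
  have h1 : ∀ᶠ x : ℝ in atTop, Real.log x ^ 5 ≤ x := by
    filter_upwards [(Real.isLittleO_pow_log_id_atTop (n := 5)).bound one_pos,
      eventually_ge_atTop 1] with x hx hx1
    rw [one_mul, id, Real.norm_of_nonneg (zero_le_one.trans hx1 : 0 ≤ x)] at hx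
    exact (le_abs_self _).trans hx
  -- The value `20` gives `5 * L / l ≤ L / 4` and `scale L ≤ L / 12`; `R₀ + 1` and `exp c + 1`
  -- absorb the floor in `scale`; `2 / c` brings the final exponent below `-1`.
  have h2 := Real.tendsto_log_atTop.eventually_ge_atTop (max (max 20 (R₀ + 1)) (Real.exp c + 1))
  have h3 := Real.tendsto_log_atTop.eventually_ge_atTop (2 / c)
  obtain ⟨Λ, hΛ⟩ := eventually_atTop.1 ((h1.and (h2.and h3)).and (eventually_ge_atTop 2))
  refine ⟨Λ, fun L hL => ?_⟩
  obtain ⟨⟨hl5, hmax, hlc⟩, hL2⟩ := hΛ L hL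
  have hl20 : 20 ≤ Real.log L := ((le_max_left _ _).trans (le_max_left _ _)).trans hmax
  have hlR : (R₀ : ℝ) + 1 ≤ Real.log L := ((le_max_right _ _).trans (le_max_left _ _)).trans hmax
  have hle : Real.exp c + 1 ≤ Real.log L := (le_max_right _ _).trans hmax
  set l := Real.log L with hl
  have hl0 : 0 < l := by linarith
  have hL0 : 0 < L := by linarith
  have hdiv : l ≤ L / l ^ 4 := by
    rw [le_div_iff₀ (by positivity)]
    calc l * l ^ 4 = l ^ 5 := by ring
      _ ≤ L := hl5
  have hs1 : (scale L : ℝ) ≤ L / l ^ 4 := Nat.floor_le (by positivity)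
  have hs2 : L / l ^ 4 < scale L + 1 := Nat.lt_floor_add_one _
  have hs3 : Real.exp c ≤ scale L := by linarith
  have hs4 : c ≤ Real.log (scale L) := by
    rw [Real.le_log_iff_exp_le ((Real.exp_pos c).trans_le hs3)]; exact hs3
  have hs5 : Real.log (scale L) ≤ l := by
    refine Real.log_le_log ((Real.exp_pos c).trans_le hs3) (hs1.trans ?_)
    exact div_le_self hL0.le (one_le_pow₀ (by linarith))
  have hn1 : ((⌊l ^ 3⌋₊ : ℕ) : ℝ) ≤ l ^ 3 := Nat.floor_le (by positivity)
  have hn2 : l ^ 3 < (⌊l ^ 3⌋₊ : ℕ) + 1 := Nat.lt_floor_add_one _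
  have hl3 : (20 : ℝ) ≤ l ^ 3 := hl20.trans (le_self_pow₀ (by linarith) (by norm_num))
  have h0 : 0 ≤ 1 - c / Real.log (scale L) := by
    rw [sub_nonneg, div_le_one (hc.trans_le hs4)]; exact hs4
  refine ⟨hL2, by linarith, ?_, ?_, ⌊l ^ 3⌋₊, ?_, h0, ?_, ?_⟩
  · have : (R₀ : ℝ) ≤ scale L := by linarith
    exact_mod_cast this
  · refine hs1.trans (div_le_div_of_nonneg_left hL0.le (by norm_num) ?_)
    have : l ≤ l ^ 4 := le_self_pow₀ (by linarith) (by norm_num)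
    linarith
  · push_cast
    calc ((⌊l ^ 3⌋₊ : ℕ) : ℝ) * (5 * scale L) ≤ l ^ 3 * (5 * (L / l ^ 4)) := by gcongr
      _ = 5 * L / l := by field_simp
      _ ≤ L / 4 := by rw [div_le_div_iff₀ hl0 (by norm_num)]; nlinarith
  · have h4 : 1 - c / Real.log (scale L) ≤ Real.exp (-(c / l)) := by
      have h5 : c / l ≤ c / Real.log (scale L) :=
        div_le_div_of_nonneg_left hc.le (hc.trans_le hs4) hs5
      have := Real.add_one_le_exp (-(c / l))
      linarith
    refine (pow_le_pow_left₀ h0 h4 _).trans ?_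
    rw [← Real.exp_nat_mul]
    refine Real.exp_le_exp.2 ?_
    have h6 : l ^ 3 / 2 * (c / l) ≤ (⌊l ^ 3⌋₊ : ℕ) * (c / l) := by
      gcongr
      linarith
    have h7 : l ^ 3 / 2 * (c / l) = c / 2 * l ^ 2 := by field_simp
    linarith
  · have h8 : 1 ≤ c / 2 * l := by
      rw [div_le_iff₀ hc] at hlc
      linarith
    have h9 : -(c / 2) * l ^ 2 ≤ -1 := by nlinarith
    refine (Real.exp_le_exp.2 h9).trans ?_
    rw [Real.exp_neg, one_div]
    refine inv_anti₀ (by norm_num) ?_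
    have := Real.add_one_le_exp (1 : ℝ)
    linarith

/-! ### Nested marks at growing scales -/

/-- Nested marks: rank `r + 1` is given to the marks of rank `r` that are selected by thinning. -/
def rankSet (v : ℕ → Bool) (ℓ : ℕ) (k R : ℕ → ℕ) : ℕ → ℤ → Set (ℤ → Bool)
  | 0 => fun i => {y | y i = true}
  | r + 1 => thinning (rankSet v ℓ k R r) (wordPower v ℓ (k (r + 1))) (R (r + 1))

/-- The properties of nested marks whose consecutive occurrences are mostly at a distance between
`L r / log ^ 4 (L r)` and `L r`. -/
structure IsMarkSystem (ν : Measure (ℤ → Bool)) (L : ℕ → ℝ) (b : ℝ)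
    (S : ℕ → ℤ → Set (ℤ → Bool)) : Prop where
  subset_true : ∀ i, S 0 i ⊆ {y | y i = true}
  succ_subset : ∀ r i, S (r + 1) i ⊆ S r i
  equivariant : ∀ r, IsEquivariant (S r)
  pastEvent : ∀ r i, PastEvent i (S r i)
  isLocal : ∀ r ≥ 1, ∃ ρ : ℕ, (ρ : ℝ) ≤ L r / 4 ∧ IsLocal ρ (S r)
  separated : ∀ r ≥ 1, ∀ i j y, y ∈ S r i → y ∈ S r j → i < j →
    L r / Real.log (L r) ^ 4 ≤ ((j - i : ℤ) : ℝ)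
  avoidance : ∀ r ≥ 1, ∃ N : ℕ, (N : ℝ) ≤ L r / 4 ∧
    AvoidanceBound ν (S r) N (Real.exp (-b * Real.log (L r) ^ 2))

/-- The growth condition gives `scale (L (r + 1)) ≥ L r - 1`, which exceeds both the waiting time
and the range of marks of rank `r`. Hence these marks qualify for the next thinning. -/
theorem IsRecurrentLaw.exists_markSystem {ν : Measure (ℤ → Bool)} {v : ℕ → Bool} {ℓ : ℕ}
    {p δ : ℝ} {N : ℕ} (h : IsRecurrentLaw ν v ℓ p δ N) :
    ∃ Λ b : ℝ, 0 < b ∧ 2 ≤ Λ ∧ (∀ x ≥ Λ, 2 ≤ Real.log x) ∧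
      (∀ x ≥ Λ, Real.exp (-b * Real.log x ^ 2) ≤ 1 / 2) ∧
      ∀ L : ℕ → ℝ, (∀ r ≥ 1, Λ ≤ L r) →
      (∀ r ≥ 1, L r < L (r + 1) / Real.log (L (r + 1)) ^ 4) →
        ∃ S, IsMarkSystem ν L b S := by
  have := h.isProbabilityMeasure
  obtain ⟨c, hc, R₀, hR₀⟩ := h.exists_scale
  obtain ⟨n₀, hn₀⟩ : ∃ n : ℕ, (1 - δ) ^ n ≤ 1 / 2 := by
    obtain ⟨n, hn⟩ := exists_pow_lt_of_lt_one (show (0 : ℝ) < 1 / 2 by norm_num)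
      (show 1 - δ < 1 by linarith [h.δ_pos])
    exact ⟨n, hn.le⟩
  obtain ⟨Λ, hΛ⟩ := exists_scale_threshold hc (max R₀ (n₀ * N))
  refine ⟨max Λ 2, c / 2, by positivity, le_max_right _ _,
    fun x hx => (hΛ x ((le_max_left _ _).trans hx)).2.1, fun x hx => ?_, fun L hL hgrow => ?_⟩
  · obtain ⟨_, _, _, _, n, _, _, _, hh⟩ := hΛ x ((le_max_left _ _).trans hx)
    exact hh
  replace hL : ∀ r ≥ 1, Λ ≤ L r := fun r hr => (le_max_left _ _).trans (hL r hr)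
  have hex : ∀ r : ℕ, ∃ k : ℕ, 1 ≤ r → k * ℓ ≤ scale (L r) ∧ ∀ S : ℤ → Set (ℤ → Bool),
      (∀ i, PastEvent i (S i)) → AvoidanceBound ν S (scale (L r)) (1 / 2) →
        AvoidanceBound ν (thinning S (wordPower v ℓ k) (scale (L r))) (5 * scale (L r))
          (1 - c / Real.log (scale (L r))) := by
    intro r
    by_cases hr : 1 ≤ r
    · obtain ⟨_, _, h1, _⟩ := hΛ (L r) (hL r hr)
      obtain ⟨k, hk⟩ := hR₀ (scale (L r)) ((le_max_left _ _).trans h1)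
      exact ⟨k, fun _ => hk⟩
    · exact ⟨0, fun h => absurd h hr⟩
  choose k hk using hex
  set S := rankSet v ℓ k (fun r => scale (L r)) with hS
  have hSsucc : ∀ r, S (r + 1) =
    thinning (S r) (wordPower v ℓ (k (r + 1))) (scale (L (r + 1))) := fun r => rfl
  have hsc : ∀ r ≥ 1, L r - 1 ≤ scale (L (r + 1)) := by
    intro r hr
    have h1 := hgrow r hr
    have h2 : L (r + 1) / Real.log (L (r + 1)) ^ 4 < scale (L (r + 1)) + 1 :=
      Nat.lt_floor_add_one _
    linarith
  -- The bound by `2 * scale (L (r + 1))` is the hypothesis of the next thinning.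
  have hlocal : ∀ r, ∃ ρ : ℕ, IsLocal ρ (S r) ∧ ρ ≤ 2 * scale (L (r + 1)) ∧
      (1 ≤ r → ρ = 3 * scale (L r)) := by
    intro r
    induction r with
    | zero =>
      refine ⟨0, ?_, Nat.zero_le _, fun h => absurd h (by norm_num)⟩
      have := isLocal_wordPower v ℓ 0
      rwa [zero_mul] at this
    | succ r ih =>
      obtain ⟨ρ, hρ, hρ2, _⟩ := ih
      refine ⟨3 * scale (L (r + 1)), ?_, ?_, fun _ => rfl⟩
      · rw [hSsucc]
        exact (hρ.mono hρ2).thinning ((isLocal_wordPower v ℓ _).mono (hk (r + 1) (by omega)).1)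
      · obtain ⟨h1, _, _, h2, _⟩ := hΛ (L (r + 1)) (hL (r + 1) (by omega))
        have h3 := hsc (r + 1) (by omega)
        have : ((3 * scale (L (r + 1)) : ℕ) : ℝ) ≤ (2 * scale (L (r + 1 + 1)) : ℕ) := by
          push_cast; linarith
        exact_mod_cast this
  have hpast : ∀ r i, PastEvent i (S r i) := by
    intro r
    obtain ⟨ρ, hρ, _⟩ := hlocal r
    exact hρ.pastEvent
  have hav : ∀ r, AvoidanceBound ν (S r) (scale (L (r + 1))) (1 / 2) ∧ (1 ≤ r → ∃ N : ℕ,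
      (N : ℝ) ≤ L r / 4 ∧
      AvoidanceBound ν (S r) N (Real.exp (-(c / 2) * Real.log (L r) ^ 2))) := by
    intro r
    induction r with
    | zero =>
      refine ⟨?_, fun h => absurd h (by norm_num)⟩
      obtain ⟨_, _, h1, _⟩ := hΛ (L (0 + 1)) (hL _ (by omega))
      exact (h.recurrent.iterate (by linarith [h.δ_le_one]) (hpast 0) n₀).mono
        ((le_max_right _ _).trans h1) hn₀
    | succ r ih =>
      obtain ⟨h1, _, _, _, n, h3, h4, h5, h6⟩ := hΛ (L (r + 1)) (hL (r + 1) (by omega))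
      have hstep := (hk (r + 1) (by omega)).2 (S r) (hpast r) ih.1
      have hit := (hstep.iterate h4 (hpast (r + 1)) n).mono le_rfl h5
      refine ⟨hit.mono ?_ h6, fun _ => ⟨_, h3, hit⟩⟩
      have h7 := hsc (r + 1) (by omega)
      have : ((n * (5 * scale (L (r + 1))) : ℕ) : ℝ) ≤ scale (L (r + 1 + 1)) := by linarith
      exact_mod_cast this
  have hequiv : ∀ r, IsEquivariant (S r) := by
    intro r
    induction r with
    | zero => exact isEquivariant_wordPower v ℓ 0
    | succ r ih => rw [hSsucc]; exact ih.thinning (isEquivariant_wordPower v ℓ _)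
  refine ⟨S, fun i => subset_rfl, fun r i => ?_, hequiv, hpast, fun r hr => ?_,
    fun r hr i j y hi hj hij => ?_, fun r hr => (hav r).2 hr⟩
  · rw [hSsucc]; exact thinning_subset
  · obtain ⟨ρ, hρ, _, hρ3⟩ := hlocal r
    refine ⟨ρ, ?_, hρ⟩
    obtain ⟨h1, _, _, h2, _⟩ := hΛ (L r) (hL r hr)
    rw [hρ3 hr]
    push_cast
    linarith
  · obtain ⟨r, rfl⟩ : ∃ r', r = r' + 1 := ⟨r - 1, by omega⟩
    have h1 : i + scale (L (r + 1)) < j := thinning_separated hi hj hij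
    have h2 : L (r + 1) / Real.log (L (r + 1)) ^ 4 < scale (L (r + 1)) + 1 :=
      Nat.lt_floor_add_one _
    have h3 : ((scale (L (r + 1)) : ℤ) : ℝ) + 1 ≤ ((j - i : ℤ) : ℝ) := by
      exact_mod_cast (show (scale (L (r + 1)) : ℤ) + 1 ≤ j - i by omega)
    push_cast at h3 ⊢
    linarith

/-! ### From nested marks to marker sequences and skeletons -/

theorem IsEquivariant.measure_eq {B : Type*} [MeasurableSpace B] {ν : Measure (ℤ → B)}
    (h : MeasurePreserving (shift : (ℤ → B) → (ℤ → B)) ν ν) {G : ℤ → Set (ℤ → B)}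
    (hG : IsEquivariant G) (hm : ∀ i, MeasurableSet (G i)) (i : ℤ) : ν (G i) = ν (G 0) := by
  have hstep : ∀ i, ν (G (i + 1)) = ν (G i) := fun i => by
    rw [← h.measure_preimage (hm i).nullMeasurableSet]
    congr 1
    ext y
    exact (hG i y).symm
  induction i using Int.induction_on with
  | zero => rfl
  | succ n ih => rw [hstep, ih]
  | pred n ih => rw [← ih, ← hstep, sub_add_cancel]

open Classical in
/-- The largest rank of `i` (zero if it has all ranks). -/
noncomputable def markRank {B : Type*} (S : ℕ → ℤ → Set (ℤ → B)) (y : ℤ → B) (i : ℤ) : ℕ :=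
  ⨆ r : ℕ, if y ∈ S r i then r else 0

section MarkRank

variable {B : Type*} {S : ℕ → ℤ → Set (ℤ → B)}

theorem subset_of_succ_subset (hS : ∀ r i, S (r + 1) i ⊆ S r i) {r s : ℕ} (h : s ≤ r) (i : ℤ) :
    S r i ⊆ S s i :=
  antitone_nat_of_succ_le (f := fun r => S r i) (fun r => hS r i) h

theorem le_markRank_iff (hS : ∀ r i, S (r + 1) i ⊆ S r i) {y : ℤ → B} {i : ℤ}
    (hy : ∃ r, y ∉ S r i) {r : ℕ} (hr : 1 ≤ r) : r ≤ markRank S y i ↔ y ∈ S r i := by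
  classical
  constructor
  · intro h
    by_contra hn
    have : markRank S y i ≤ r - 1 := ciSup_le fun s => by
      split_ifs with hs
      · by_contra hlt
        exact hn (subset_of_succ_subset hS (by omega) i hs)
      · exact Nat.zero_le _
    omega
  · intro h
    obtain ⟨q, hq⟩ := hy
    have hb : BddAbove (Set.range fun s : ℕ => if y ∈ S s i then s else 0) := by
      refine ⟨q, ?_⟩
      rintro _ ⟨s, rfl⟩
      dsimp only
      split_ifs with hs
      · by_contra hlt
        exact hq (subset_of_succ_subset hS (by omega) i hs)
      · exact Nat.zero_le _
    have := le_ciSup hb r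
    rwa [if_pos h] at this

theorem measurable_markRank [MeasurableSpace B] (hS : ∀ r i, MeasurableSet (S r i)) :
    Measurable (markRank S) := by
  classical
  refine measurable_pi_lambda _ fun i => ?_
  exact Measurable.iSup fun r => Measurable.ite (hS r i) measurable_const measurable_const

theorem markRank_shift (hS : ∀ r, IsEquivariant (S r)) (y : ℤ → B) :
    markRank S (shift y) = shift (markRank S y) := by
  funext i
  classical
  exact iSup_congr fun r => if_congr (hS r i y) rfl rfl

end MarkRank

theorem exists_isRSkeleton {m : ℤ → ℕ} {r N : ℕ} {i j : ℤ} (hi : r ≤ m i) (hj : r ≤ m j)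
    (hi1 : -N < i) (hi2 : i ≤ 0) (hj1 : 0 < j) (hj2 : j ≤ N) :
    ∃ α β : ℤ, IsRSkeleton m r α β ∧ -N < α ∧ α ≤ 0 ∧ 0 ≤ β ∧ β < N := by
  obtain ⟨α, ⟨hα1, hα2⟩, hα⟩ := Int.exists_greatest_of_bdd (P := fun z => r ≤ m z ∧ z ≤ 0)
    ⟨0, fun z hz => hz.2⟩ ⟨i, hi, hi2⟩
  obtain ⟨γ, ⟨hγ1, hγ2⟩, hγ⟩ := Int.exists_least_of_bdd (P := fun z => r ≤ m z ∧ 0 < z)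
    ⟨0, fun z hz => hz.2.le⟩ ⟨j, hj, hj1⟩
  have h1 := hα i ⟨hi, hi2⟩
  have h2 := hγ j ⟨hj, hj1⟩
  refine ⟨α, γ - 1, ⟨by omega, hα1, by rwa [sub_add_cancel], fun z hz1 hz2 => ?_⟩,
    by omega, by omega, by omega, by omega⟩
  by_contra! hz
  rcases le_or_gt z 0 with h | h
  · have := hα z ⟨hz, h⟩; omega
  · have := hγ z ⟨hz, h⟩; omega

theorem skeletonAt_eq_singleton {y : ℤ → Bool} {m : ℤ → ℕ} {r : ℕ} {α β o : ℤ}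
    (h : IsRSkeleton m r α β) (h1 : α ≤ o) (h2 : o ≤ β) :
    skeletonAt y m r o = {mkSkeleton y m r α β} :=
  (skeletonAt_subsingleton y m r o).eq_singleton_of_mem ⟨α, β, h, h1, h2, rfl⟩

/-- Comparing truncated ranks suffices, but also at `β + 1`, where the mark that closes the skeleton
sits. -/
theorem skeletonAt_congr {y y' : ℤ → Bool} {m m' : ℤ → ℕ} {r : ℕ} (hr : 1 ≤ r) {α β o : ℤ}
    (h : IsRSkeleton m r α β) (h1 : α ≤ o) (h2 : o ≤ β)
    (hy : ∀ i, α ≤ i → i ≤ β → y i = y' i)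
    (hm : ∀ i, α ≤ i → i ≤ β + 1 → ∀ s, 1 ≤ s → s ≤ r → (s ≤ m i ↔ s ≤ m' i)) :
    skeletonAt y' m' r o = skeletonAt y m r o := by
  have hle := h.le
  have hmr : ∀ i, α ≤ i → i ≤ β + 1 → (r ≤ m i ↔ r ≤ m' i) :=
    fun i hi1 hi2 => hm i hi1 hi2 r hr le_rfl
  have h' : IsRSkeleton m' r α β := by
    refine ⟨hle, (hmr α le_rfl (by omega)).1 h.left_ge,
      (hmr _ (by omega) le_rfl).1 h.right_ge, fun i hi1 hi2 => ?_⟩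
    rw [← not_le, ← hmr i (by omega) (by omega), not_le]
    exact h.interior_lt i hi1 hi2
  rw [skeletonAt_eq_singleton h h1 h2, skeletonAt_eq_singleton h' h1 h2]
  congr 1
  simp only [mkSkeleton, Skeleton.mk.injEq, true_and]
  funext i
  split_ifs with hi
  · have e : min (m' i) r = min (m i) r := by
      refine eq_of_forall_le_iff fun s => ?_
      rcases Nat.eq_zero_or_pos s with rfl | hs
      · simp
      · simp only [le_min_iff]
        refine and_congr_left fun hsr => ?_
        exact (hm i hi.1 (by omega) s hs hsr).symm
    rw [e, hy i hi.1 hi.2]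
  · rfl

section Growth

variable {L : ℕ → ℝ}

theorem tendsto_atTop_of_growth (h2 : ∀ r ≥ 1, 2 ≤ L r)
    (hlog : ∀ r ≥ 1, 2 ≤ Real.log (L r))
    (hL : ∀ r ≥ 1, L r < L (r + 1) / Real.log (L (r + 1)) ^ 4) :
    (∀ r ≥ 1, L r + 1 ≤ L (r + 1)) ∧ Tendsto L atTop atTop := by
  have hstep : ∀ r ≥ 1, L r + 1 ≤ L (r + 1) := fun r hr => by
    have h1 := hL r hr
    have h3 : (2 : ℝ) ^ 4 ≤ Real.log (L (r + 1)) ^ 4 :=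
      pow_le_pow_left₀ (by norm_num) (hlog (r + 1) (by omega)) 4
    rw [lt_div_iff₀ (by linarith)] at h1
    have := h2 r hr
    nlinarith
  refine ⟨hstep, tendsto_atTop_mono' atTop ?_ tendsto_natCast_atTop_atTop⟩
  filter_upwards [eventually_ge_atTop 1] with r hr
  induction r, hr using Nat.le_induction with
  | base => have := h2 1 le_rfl; push_cast; linarith
  | succ r hr ih => have := hstep r hr; push_cast; linarith

end Growth

namespace IsMarkSystem

variable {ν : Measure (ℤ → Bool)} {L : ℕ → ℝ} {b : ℝ} {S : ℕ → ℤ → Set (ℤ → Bool)}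

/-- Two coordinates of infinite rank would contradict the separation at large ranks. The events at
different coordinates are thus disjoint and of equal measure, which must be zero. -/
theorem measure_infinite_rank [IsProbabilityMeasure ν]
    (hν : MeasurePreserving (shift : (ℤ → Bool) → (ℤ → Bool)) ν ν) (h : IsMarkSystem ν L b S)
    (hL : Tendsto L atTop atTop) (hgrow : ∀ r ≥ 1, L r < L (r + 1) / Real.log (L (r + 1)) ^ 4) :
    ν {y | ∃ i, ∀ r, y ∈ S r i} = 0 := by
  let E : ℤ → Set (ℤ → Bool) := fun i => {y | ∀ r, y ∈ S r i}
  have hE : IsEquivariant E := fun i y => forall_congr' fun r => h.equivariant r i y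
  have hm : ∀ i, MeasurableSet (E i) := fun i => by
    have : E i = ⋂ r, S r i := by ext y; simp [E]
    rw [this]
    exact MeasurableSet.iInter fun r => (h.pastEvent r i).measurableSet
  have hdis : ∀ i j y, y ∈ E i → y ∈ E j → ¬ i < j := by
    intro i j y hi hj hij
    obtain ⟨r, hr, hr1⟩ := ((hL.eventually_ge_atTop ((j - i : ℤ) : ℝ)).and
      (eventually_ge_atTop 1)).exists
    have h1 := h.separated (r + 1) (by omega) i j y (hi _) (hj _) hij
    have h2 := hgrow r hr1
    linarith
  have hpair : Pairwise (Function.onFun Disjoint E) := by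
    intro i j hij
    refine Set.disjoint_left.2 fun y hi hj => ?_
    rcases lt_or_gt_of_ne hij with h | h
    · exact hdis i j y hi hj h
    · exact hdis j i y hj hi h
  have hsum : ∑' i, ν (E i) ≠ ⊤ := by
    rw [← measure_iUnion hpair hm]; exact measure_ne_top _ _
  have h0 : ν (E 0) = 0 := by
    by_contra hne
    refine hsum ?_
    rw [show (fun i => ν (E i)) = fun _ => ν (E 0) from
      funext fun i => hE.measure_eq hν hm i]
    exact ENNReal.tsum_const_eq_top_of_ne_zero hne
  have : {y | ∃ i, ∀ r, y ∈ S r i} = ⋃ i, E i := by ext y; simp [E]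
  rw [this]
  exact measure_iUnion_null fun i => (hE.measure_eq hν hm i).trans h0

theorem measure_pos [IsProbabilityMeasure ν]
    (hν : MeasurePreserving (shift : (ℤ → Bool) → (ℤ → Bool)) ν ν) (h : IsMarkSystem ν L b S)
    {r : ℕ} (hr : 1 ≤ r) (hb : Real.exp (-b * Real.log (L r) ^ 2) ≤ 1 / 2) :
    0 < ν (S r 0) := by
  rw [pos_iff_ne_zero]
  intro h0
  obtain ⟨N, _, hN⟩ := h.avoidance r hr
  have h1 : ν (hitSet (S r) 0 N) = 0 := by
    refine measure_mono_null (t := ⋃ i, S r i) ?_ (measure_iUnion_null fun i => ?_)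
    · rintro y ⟨t, _, _, ht⟩
      exact Set.mem_iUnion.2 ⟨_, ht⟩
    · rw [(h.equivariant r).measure_eq hν fun i => (h.pastEvent r i).measurableSet, h0]
  have h2 := hN 0 Set.univ PastEvent.univ
  have h3 := measureReal_inter_add_sdiff (μ := ν) (s := Set.univ)
    (PastEvent.hitSet (h.pastEvent r) 0 N).measurableSet
  rw [Set.univ_inter, measureReal_def, h1] at h3
  simp only [probReal_univ, ENNReal.toReal_zero] at h2 h3
  linarith

end IsMarkSystem

/-! ### The marker factor and its error bounds -/

namespace IsAperiodicMarkov

variable {A : Type*} [Finite A] [MeasurableSpace A] [DiscreteMeasurableSpace A]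
  {μ : Measure (ℤ → A)}

/-- Outside an event of probability at most `2 * ε`, marks of rank `r` occur in `(-N, 0]` and in
`(0, N]` with `N ≤ L r / 4`. The skeleton then lies in this range, and reading its marks takes at
most `L r / 4` more coordinates. -/
theorem exists_markerFactor [Nontrivial A] (hX : IsAperiodicMarkov μ) (a : A) :
    ∃ Λ b : ℝ, 0 < b ∧ 2 ≤ Λ ∧ (∀ x ≥ Λ, 2 ≤ Real.log x) ∧
      ∀ L : ℕ → ℝ, (∀ r ≥ 1, Λ ≤ L r) →
      (∀ r ≥ 1, L r < L (r + 1) / Real.log (L (r + 1)) ^ 4) →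
      ∃ ξ, IsMarkerFactor μ a ξ ∧ ∀ r ≥ 1,
        (∀ t ≥ L r, 1 - μ.real (determinesSkeleton μ a ξ r t) ≤
          2 * Real.exp (-b * Real.log (L r) ^ 2)) ∧
        1 - μ.real {x | ∃ s ∈ randomSkeleton a ξ r x,
          L r / Real.log (L r) ^ 4 ≤ (s.size : ℝ) ∧ (s.size : ℝ) ≤ L r} ≤
          2 * Real.exp (-b * Real.log (L r) ^ 2) := by
  have := hX.isProbabilityMeasure
  obtain ⟨v, ℓ, p, δ, N₀, hlaw⟩ := hX.exists_isRecurrentLaw a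
  obtain ⟨Λ, b, hb, hΛ2, hΛlog, hΛexp, hΛ⟩ := hlaw.exists_markSystem
  refine ⟨Λ, b, hb, hΛ2, hΛlog, fun L hL hgrow => ?_⟩
  obtain ⟨S, hS⟩ := hΛ L hL hgrow
  have hφ : Measurable (stateDistribution a : (ℤ → A) → _) := measurable_stateDistribution a
  set ν := μ.map (stateDistribution a) with hνdef
  have : IsProbabilityMeasure ν := hlaw.isProbabilityMeasure
  have hν := hlaw.stationary
  obtain ⟨hstep, htend⟩ := tendsto_atTop_of_growth (fun r hr => hΛ2.trans (hL r hr))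
    (fun r hr => hΛlog _ (hL r hr)) hgrow
  have hZ := hS.measure_infinite_rank hν htend hgrow
  have hmono : ∀ s r, 1 ≤ s → s ≤ r → L s ≤ L r := by
    intro s r hs hsr
    induction r, hsr using Nat.le_induction with
    | base => exact le_rfl
    | succ r hr ih => have := hstep r (by omega); linarith
  have hSm : ∀ r i, MeasurableSet (S r i) := fun r i => (hS.pastEvent r i).measurableSet
  have hZμ : ∀ᵐ x ∂μ, ∀ i, ∃ r, stateDistribution a x ∉ S r i := by
    have h1 : ∀ᵐ y ∂ν, ∀ i, ∃ r, y ∉ S r i := by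
      rw [ae_iff]
      convert hZ using 3
      push Not
      rfl
    exact ae_of_ae_map hφ.aemeasurable h1
  have hrank : ∀ x : ℤ → A, (∀ i, ∃ r, stateDistribution a x ∉ S r i) → ∀ i r, 1 ≤ r →
      (r ≤ markRank S (stateDistribution a x) i ↔ stateDistribution a x ∈ S r i) :=
    fun x hx i r hr => le_markRank_iff hS.succ_subset (hx i) hr
  refine ⟨markRank S, ⟨measurable_markRank hSm, markRank_shift hS.equivariant, ?_, ?_⟩, ?_⟩
  · intro y hy
    by_contra hn
    have h0 : ∀ r, y ∉ S r 0 := fun r hr =>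
      hn (hS.subset_true 0 (subset_of_succ_subset hS.succ_subset (Nat.zero_le r) 0 hr))
    have : markRank S y 0 = 0 := by simp [markRank, h0]
    omega
  · intro r hr
    have h1 := hS.measure_pos hν hr (hΛexp _ (hL r hr))
    rw [hνdef, Measure.map_apply hφ (hSm r 0)] at h1
    refine h1.trans_le (measure_mono_ae ?_)
    filter_upwards [hZμ] with x hx hxr
    exact (hrank x hx 0 r hr).2 hxr
  intro r hr
  obtain ⟨N, hNL, hN⟩ := hS.avoidance r hr
  set ε := Real.exp (-b * Real.log (L r) ^ 2)
  set H : Set (ℤ → Bool) := hitSet (S r) (-N) N ∩ hitSet (S r) 0 N with hH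
  have hhit : ∀ m, MeasurableSet (hitSet (S r) m N) :=
    fun m => (PastEvent.hitSet (hS.pastEvent r) m N).measurableSet
  have hbound : ∀ E : Set (ℤ → A), (∀ x, (∀ i, ∃ r, stateDistribution a x ∉ S r i) →
      stateDistribution a x ∈ H → x ∈ E) → 1 - μ.real E ≤ 2 * ε := by
    intro E hE
    have h1 := hN (-N) Set.univ PastEvent.univ
    have h2 := hN 0 Set.univ PastEvent.univ
    rw [probReal_univ, mul_one] at h1 h2
    have h3 : 1 - ν.real H ≤ ν.real (Set.univ \ hitSet (S r) (-N) N) +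
        ν.real (Set.univ \ hitSet (S r) 0 N) := by
      have h4 := measureReal_inter_add_sdiff (μ := ν) (s := Set.univ)
        ((hhit (-N)).inter (hhit 0))
      rw [Set.univ_inter, probReal_univ] at h4
      have h5 := measureReal_union_le (μ := ν) (Set.univ \ hitSet (S r) (-N) N)
        (Set.univ \ hitSet (S r) 0 N)
      rw [← Set.sdiff_inter] at h5
      linarith
    have h6 : ν.real H ≤ μ.real E := by
      rw [map_measureReal_apply hφ ((hhit _).inter (hhit 0))]
      refine ENNReal.toReal_mono (measure_ne_top _ _) (measure_mono_ae ?_)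
      filter_upwards [hZμ] with x hx hxH
      exact hE x hx hxH
    linarith
  have hskel : ∀ x, (∀ i, ∃ r, stateDistribution a x ∉ S r i) → stateDistribution a x ∈ H →
      ∃ α β : ℤ, IsRSkeleton (markRank S (stateDistribution a x)) r α β ∧
        -N < α ∧ α ≤ 0 ∧ 0 ≤ β ∧ β < N := by
    rintro x hx ⟨⟨t, ht1, ht2, ht⟩, ⟨t', ht1', ht2', ht'⟩⟩
    exact exists_isRSkeleton ((hrank x hx _ r hr).2 ht) ((hrank x hx _ r hr).2 ht')
      (by omega) (by omega) (by omega) (by omega)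
  have hLr : 2 ≤ L r := hΛ2.trans (hL r hr)
  refine ⟨fun t ht => hbound _ fun x hx hxH => ?_, hbound _ fun x hx hxH => ?_⟩
  · obtain ⟨α, β, hsk, hα1, hα2, hβ1, hβ2⟩ := hskel x hx hxH
    change ∀ᵐ x' ∂μ, window t x' = window t x → _
    filter_upwards [hZμ] with x' hx' hw
    have hcoord : ∀ i : ℤ, -⌊t⌋ ≤ i → i ≤ ⌊t⌋ →
        stateDistribution a x i = stateDistribution a x' i := by
      intro i h1 h2
      have := congrFun hw ⟨i, h1, h2⟩
      simp only [window] at this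
      simp [stateDistribution, this]
    have hNt : (N : ℤ) ≤ ⌊t⌋ := Int.le_floor.2 (by push_cast; linarith)
    refine skeletonAt_congr hr hsk hα2 hβ1
      (fun i h1 h2 => hcoord i (by omega) (by omega)) fun i h1 h2 s hs hsr => ?_
    rw [hrank x hx i s hs, hrank x' hx' i s hs]
    obtain ⟨ρ, hρ, hloc⟩ := hS.isLocal s hs
    have hNρ : (N : ℤ) + ρ ≤ ⌊t⌋ := by
      have := hmono s r hs hsr
      exact Int.le_floor.2 (by push_cast; linarith)
    have hc : ∀ j, i - ρ ≤ j → j ≤ i → stateDistribution a x j = stateDistribution a x' j :=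
      fun j hj1 hj2 => hcoord j (by omega) (by omega)
    exact ⟨hloc i _ _ hc, hloc i _ _ fun j hj1 hj2 => (hc j hj1 hj2).symm⟩
  · obtain ⟨α, β, hsk, hα1, hα2, hβ1, hβ2⟩ := hskel x hx hxH
    refine ⟨_, ⟨α, β, hsk, hα2, hβ1, rfl⟩, ?_, ?_⟩
    · have := hS.separated r hr α (β + 1) _ ((hrank x hx _ r hr).1 hsk.left_ge)
        ((hrank x hx _ r hr).1 hsk.right_ge) (by omega)
      refine this.trans (le_of_eq ?_)
      simp only [Skeleton.size, mkSkeleton]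
      push_cast; ring
    · have h1 : ((β - α + 1 : ℤ) : ℝ) ≤ ((2 * N : ℤ) : ℝ) := by
        exact_mod_cast (show β - α + 1 ≤ 2 * (N : ℤ) by omega)
      simp only [Skeleton.size, mkSkeleton]
      push_cast at h1 ⊢
      linarith

end IsAperiodicMarkov

/-! ### Superpolynomial decay and the two conclusions -/

theorem superpolynomialDecay_of_le_exp {ι : Type*} {l : Filter ι} {k f : ι → ℝ}
    (hk : Tendsto k l atTop) {b : ℝ} (hb : 0 < b) (h0 : ∀ i, 0 ≤ f i)
    (hf : ∀ᶠ i in l, f i ≤ 2 * Real.exp (-b * Real.log (k i) ^ 2)) :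
    SuperpolynomialDecay l k f := by
  intro n
  -- Here `u` is the logarithm of the parameter, so that its `n`-th power is `exp (n * u)`.
  have h1 : Tendsto (fun u : ℝ => 2 * Real.exp (n * u - b * u ^ 2)) atTop (𝓝 0) := by
    have h2 : Tendsto (fun u : ℝ => u * (b * u - n)) atTop atTop :=
      tendsto_id.atTop_mul_atTop₀
        (tendsto_atTop_add_const_right _ _ (tendsto_id.const_mul_atTop hb))
    have h3 := (Real.tendsto_exp_neg_atTop_nhds_zero.comp h2).const_mul 2
    rw [mul_zero] at h3
    refine h3.congr fun u => ?_
    simp only [Function.comp]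
    ring_nf
  refine tendsto_of_tendsto_of_tendsto_of_le_of_le' tendsto_const_nhds
    (h1.comp (Real.tendsto_log_atTop.comp hk)) ?_ ?_
  · filter_upwards [hk.eventually_ge_atTop 0] with i hi
    exact mul_nonneg (pow_nonneg hi n) (h0 i)
  · filter_upwards [hk.eventually_gt_atTop 0, hf] with i hi hfi
    have e : k i ^ n = Real.exp (n * Real.log (k i)) := by
      rw [Real.exp_nat_mul, Real.exp_log hi]
    calc k i ^ n * f i ≤ k i ^ n * (2 * Real.exp (-b * Real.log (k i) ^ 2)) :=
          mul_le_mul_of_nonneg_left hfi (pow_nonneg hi.le n)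
      _ = 2 * Real.exp (n * Real.log (k i) - b * Real.log (k i) ^ 2) := by
          rw [e, mul_left_comm, ← Real.exp_add]; ring_nf

/-- Eventually `log ^ 8 x ≤ x`, so `L (r + 1) ≤ L r ^ 2` and `log (L (r + 1)) ≤ 2 * log (L r) < log
(L r) ^ 2`. The fourth power of this is less than the growth factor. -/
theorem exists_slowly_growing (Λ : ℝ) : ∃ L : ℕ → ℝ, ∀ r, Λ ≤ L r ∧ 2 < Real.log (L r) ∧
    0 < L r ∧ L (r + 1) = L r * Real.log (L r) ^ 8 ∧ L (r + 1) ≤ L r ^ 2 ∧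
    L r < L (r + 1) / Real.log (L (r + 1)) ^ 4 := by
  have h1 : ∀ᶠ x : ℝ in atTop, Real.log x ^ 8 ≤ x := by
    filter_upwards [(Real.isLittleO_pow_log_id_atTop (n := 8)).bound one_pos,
      eventually_ge_atTop 1] with x hx hx1
    rw [one_mul, id, Real.norm_of_nonneg (zero_le_one.trans hx1 : 0 ≤ x)] at hx
    exact (le_abs_self _).trans hx
  obtain ⟨x₀, hx₀⟩ := eventually_atTop.1 ((h1.and (Real.tendsto_log_atTop.eventually_gt_atTop 2)).and
    ((eventually_ge_atTop Λ).and (eventually_gt_atTop 0)))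
  let φ : ℝ → ℝ := fun x => x * Real.log x ^ 8
  have hge : ∀ r : ℕ, x₀ ≤ φ^[r] x₀ := by
    intro r
    induction r with
    | zero => exact le_rfl
    | succ r ih =>
      obtain ⟨⟨_, h2⟩, _, h3⟩ := hx₀ _ ih
      rw [Function.iterate_succ_apply']
      exact ih.trans (le_mul_of_one_le_right h3.le (one_le_pow₀ (by linarith)))
  refine ⟨fun r => φ^[r] x₀, fun r => ?_⟩
  obtain ⟨⟨h2, h3⟩, h4, h5⟩ := hx₀ _ (hge r)
  obtain ⟨⟨_, h6⟩, _, h7⟩ := hx₀ _ (hge (r + 1))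
  have e : φ^[r + 1] x₀ = φ^[r] x₀ * Real.log (φ^[r] x₀) ^ 8 :=
    Function.iterate_succ_apply' φ r x₀
  simp only
  generalize φ^[r + 1] x₀ = z at e h6 h7
  generalize φ^[r] x₀ = x at h2 h3 h4 h5 e
  have hsq : z ≤ x ^ 2 := by rw [e, sq]; exact mul_le_mul_of_nonneg_left h2 h5.le
  refine ⟨h4, h3, h5, e, hsq, ?_⟩
  have h8 : Real.log z < Real.log x ^ 2 := by
    have := Real.log_le_log h7 hsq
    rw [Real.log_pow] at this
    push_cast at this
    nlinarith
  rw [lt_div_iff₀ (pow_pos (by linarith) 4)]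
  refine (mul_lt_mul_of_pos_left ?_ h5).trans_eq e.symm
  calc Real.log z ^ 4 < (Real.log x ^ 2) ^ 4 := pow_lt_pow_left₀ h8 (by linarith) (by norm_num)
    _ = Real.log x ^ 8 := by ring

theorem lemma1 {A : Type*} [Finite A] [Nontrivial A] [MeasurableSpace A]
    [DiscreteMeasurableSpace A] (μ : Measure (ℤ → A)) (hX : IsAperiodicMarkov μ) (a : A) :
    (∃ ξ : (ℤ → Bool) → (ℤ → ℕ), IsMarkerFactor μ a ξ ∧
      ∃ c : ℝ, 0 < c ∧ ∃ r : ℕ → ℕ,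
        SuperpolynomialDecay atTop (fun n : ℕ => (n : ℝ))
          (fun n : ℕ => 1 - μ.real (determinesSkeleton μ a ξ (r n) (n : ℝ))) ∧
        SuperpolynomialDecay atTop (fun n : ℕ => (n : ℝ))
          (fun n : ℕ => 1 - μ.real (skeletonSizeEvent a ξ (r n) c (n : ℝ)))) ∧
    (∃ M : ℝ, ∀ c : ℝ, M ≤ c → 0 < c → ∀ L : ℕ → ℝ, M ≤ L 1 → 0 < L 1 →
      (∀ r : ℕ, 1 ≤ r → L r < L (r + 1) ∧ L r < L (r + 1) / Real.log (L (r + 1)) ^ c) →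
      ∃ ξ : (ℤ → Bool) → (ℤ → ℕ), IsMarkerFactor μ a ξ ∧
        SuperpolynomialDecay atTop L
          (fun r : ℕ => 1 - μ.real (determinesSkeleton μ a ξ r (L r))) ∧
        SuperpolynomialDecay atTop L
          (fun r : ℕ => 1 - μ.real (skeletonSizeEvent a ξ r c (L r)))) := by
  have := hX.isProbabilityMeasure
  have h01 : ∀ E : Set (ℤ → A), 0 ≤ 1 - μ.real E := fun E => sub_nonneg.2 measureReal_le_one
  obtain ⟨Λ, b, hb, hΛ2, hΛlog, hmain⟩ := hX.exists_markerFactor a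
  constructor
  · obtain ⟨L, hL⟩ := exists_slowly_growing Λ
    have hLΛ : ∀ r ≥ 1, Λ ≤ L r := fun r _ => (hL r).1
    have hLg : ∀ r ≥ 1, L r < L (r + 1) / Real.log (L (r + 1)) ^ 4 :=
      fun r _ => (hL r).2.2.2.2.2
    obtain ⟨ξ, hξ, hprob⟩ := hmain L hLΛ hLg
    obtain ⟨_, htend⟩ := tendsto_atTop_of_growth (fun r hr => hΛ2.trans (hLΛ r hr))
      (fun r hr => hΛlog _ (hLΛ r hr)) hLg
    have hex : ∀ n : ℕ, ∃ r : ℕ, L 1 ≤ n → 1 ≤ r ∧ L r ≤ n ∧ (n : ℝ) < L (r + 1) := by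
      classical
      intro n
      by_cases hn : L 1 ≤ n
      · have h1 : ∃ r : ℕ, 1 ≤ r ∧ (n : ℝ) < L (r + 1) :=
          ((eventually_ge_atTop 1).and (((tendsto_add_atTop_iff_nat 1).2
            htend).eventually_gt_atTop (n : ℝ))).exists
        obtain ⟨h2, h3⟩ := Nat.find_spec h1
        refine ⟨Nat.find h1, fun _ => ⟨h2, ?_, h3⟩⟩
        rcases h2.eq_or_lt with h | h
        · rw [← h]; exact hn
        · have h4 := Nat.find_min h1 (m := Nat.find h1 - 1) (by omega)
          rw [Nat.sub_add_cancel h2] at h4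
          by_contra! h5
          exact h4 ⟨by omega, h5⟩
      · exact ⟨0, fun h => absurd h hn⟩
    choose r hr using hex
    have hev : ∀ᶠ n : ℕ in atTop, L 1 ≤ n := tendsto_natCast_atTop_atTop.eventually_ge_atTop _
    -- From `n ≤ L (r n) ^ 2`, the two logarithms differ by a factor of at most `2`; hence `b / 4`.
    have hexp : ∀ n : ℕ, L 1 ≤ n → 2 * Real.exp (-b * Real.log (L (r n)) ^ 2) ≤
        2 * Real.exp (-(b / 4) * Real.log n ^ 2) := by
      intro n hn
      obtain ⟨_, h2, h3⟩ := hr n hn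
      obtain ⟨_, h4, h5, _, h6, _⟩ := hL (r n)
      have h7 := Real.log_le_log (h5.trans_le h2) (h3.le.trans h6)
      have h8 := Real.log_le_log h5 h2
      rw [Real.log_pow] at h7
      push_cast at h7
      have h9 : Real.log n ^ 2 ≤ 4 * Real.log (L (r n)) ^ 2 := by nlinarith
      have h10 : -b * Real.log (L (r n)) ^ 2 ≤ -(b / 4) * Real.log n ^ 2 := by nlinarith
      linarith [Real.exp_le_exp.2 h10]
    -- The exponent `12` is `8 + 4`: the gap between consecutive scales and the lower bound on
    -- skeleton sizes.
    refine ⟨ξ, hξ, 12, by norm_num, r, ?_, ?_⟩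
    · refine superpolynomialDecay_of_le_exp tendsto_natCast_atTop_atTop (b := b / 4)
        (by positivity) (fun n => h01 _) ?_
      filter_upwards [hev] with n hn
      obtain ⟨h1, h2, _⟩ := hr n hn
      exact ((hprob (r n) h1).1 n h2).trans (hexp n hn)
    · refine superpolynomialDecay_of_le_exp tendsto_natCast_atTop_atTop (b := b / 4)
        (by positivity) (fun n => h01 _) ?_
      filter_upwards [hev] with n hn
      obtain ⟨h1, h2, h3⟩ := hr n hn
      refine le_trans (sub_le_sub_left (measureReal_mono ?_) 1)
        ((hprob (r n) h1).2.trans (hexp n hn))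
      rintro x ⟨s, hs, hs1, hs2⟩
      refine ⟨s, hs, le_trans ?_ hs1, hs2.trans h2⟩
      obtain ⟨_, h4, h5, h6, _, _⟩ := hL (r n)
      have h8 := Real.log_le_log h5 h2
      rw [show (12 : ℝ) = ((12 : ℕ) : ℝ) by norm_num, Real.rpow_natCast,
        div_le_div_iff₀ (pow_pos (by linarith) 12) (pow_pos (by linarith) 4)]
      calc (n : ℝ) * Real.log (L (r n)) ^ 4
          ≤ L (r n) * Real.log (L (r n)) ^ 8 * Real.log (L (r n)) ^ 4 :=
            mul_le_mul_of_nonneg_right (h6 ▸ h3.le) (by positivity)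
        _ = L (r n) * Real.log (L (r n)) ^ 12 := by ring
        _ ≤ L (r n) * Real.log n ^ 12 :=
            mul_le_mul_of_nonneg_left (pow_le_pow_left₀ (by linarith) h8 12) h5.le
  -- For `c ≥ 4` the growth condition with exponent `c` implies the one with `4`, and the size bound
  -- with `4` implies the one with `c`.
  · refine ⟨max Λ 4, fun c hc _ L hL1 _ hL => ?_⟩
    have hc4 : 4 ≤ c := (le_max_right _ _).trans hc
    have hLΛ : ∀ r ≥ 1, Λ ≤ L r := by
      intro r hr
      induction r, hr using Nat.le_induction with
      | base => exact (le_max_left _ _).trans hL1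
      | succ r hr ih => exact ih.trans (hL r hr).1.le
    have hpow : ∀ r ≥ 1, L r / Real.log (L r) ^ c ≤ L r / Real.log (L r) ^ 4 := by
      intro r hr
      have h1 := hΛlog _ (hLΛ r hr)
      have h2 := hΛ2.trans (hLΛ r hr)
      refine div_le_div_of_nonneg_left (by linarith) (pow_pos (by linarith) 4) ?_
      rw [← Real.rpow_natCast]
      exact Real.rpow_le_rpow_of_exponent_le (by linarith) (by exact_mod_cast hc4)
    have hLg : ∀ r ≥ 1, L r < L (r + 1) / Real.log (L (r + 1)) ^ 4 :=
      fun r hr => (hL r hr).2.trans_le (hpow (r + 1) (by omega))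
    obtain ⟨ξ, hξ, hprob⟩ := hmain L hLΛ hLg
    obtain ⟨_, htend⟩ := tendsto_atTop_of_growth (fun r hr => hΛ2.trans (hLΛ r hr))
      (fun r hr => hΛlog _ (hLΛ r hr)) hLg
    refine ⟨ξ, hξ, superpolynomialDecay_of_le_exp htend hb (fun r => h01 _) ?_,
      superpolynomialDecay_of_le_exp htend hb (fun r => h01 _) ?_⟩
    · filter_upwards [eventually_ge_atTop 1] with r hr
      exact (hprob r hr).1 _ le_rfl
    · filter_upwards [eventually_ge_atTop 1] with r hr
      refine le_trans (sub_le_sub_left (measureReal_mono ?_) 1) (hprob r hr).2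
      rintro x ⟨s, hs, hs1, hs2⟩
      exact ⟨s, hs, (hpow r hr).trans hs1, hs2⟩
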